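/- Let $S_n$ be the group of permutations of $[n]=\{1,\dots,n\}$ and let $\Pr$ denote probability with respect to a uniformly random $\pi\in S_n$. For $i,j\in[n]$ the coset $(i,j)$ is the set $\{\pi\in S_n:\pi(i)=j\}$, and $x_{i,j}\colon S_n\to\{0,1\}$ is its indicator function. A function $f\colon S_n\to\mathbb{R}$ is linear if $f=\sum_{i,j=1}^n c_{i,j}x_{i,j}$ for some $c_{i,j}\in\mathbb{R}$. For $A,B>0$ and $\epsilon\ge 0$, call $\mathcal{C}\subseteq[n]^2$ an $\epsilon$-disjoint family of cosets with constants $A,B$ if $|\mathcal{C}|\le An$ and at most $B\epsilon n^2$ unordered pairs of distinct elements $(i,j),(k,\ell)\in\mathcal{C}$ have cosets that are not disjoint as sets of permutations. (Direct part) There are absolute constants $A,B,K>0$ such that for every $n$, every $\epsilon\ge 0$ and every linear $f\colon S_n\to\mathbb{R}$ with $\Pr[f\notin\{0,1\}]\le\epsilon$ and $\Pr[f=1]\le 1/2$, there is an $\epsilon$-disjoint family of cosets $\mathcal{C}\subseteq[n]^2$ with constants $A,B$ such that $$\Pr\Bigl[f\ne\sum_{(i,j)\in\mathcal{C}}x_{i,j}\Bigr]\le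 K\epsilon .$$ (Converse part) For all $A,B>0$ there is a constant $K>0$ such that for every $n$, every $\epsilon\ge 0$ and every $\epsilon$-disjoint family of cosets $\mathcal{C}\subseteq[n]^2$ with constants $A,B$, the function $g=\sum_{(i,j)\in\mathcal{C}}x_{i,j}$ satisfies $\Pr[g\notin\{0,1\}]\le K\epsilon$. -/

import Mathlib

noncomputable section

namespace SymFKN

/-- The probability of an event `P` for a uniformly random permutation of `Fin n`. -/
def prob {n : ℕ} (P : Equiv.Perm (Fin n) → Prop) : ℝ :=
  open Classical in
  ((Finset.univ.filter P).card : ℝ) / (Fintype.card (Equiv.Perm (Fin n)) : ℝ)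

/-- The coset `(i, j)`: all permutations sending `i` to `j`. -/
def coset {n : ℕ} (p : Fin n × Fin n) : Set (Equiv.Perm (Fin n)) :=
  {π | π p.1 = p.2}

/-- The function `x_{i,j}`: the `0`-`1` indicator of the coset `(i, j)`. -/
def x {n : ℕ} (p : Fin n × Fin n) : Equiv.Perm (Fin n) → ℝ :=
  (coset p).indicator 1

/-- A function on permutations is linear if it is `∑ i, ∑ j, c i j * x_{i,j}`
for some real coefficients. -/
def IsLinear {n : ℕ} (f : Equiv.Perm (Fin n) → ℝ) : Prop :=
  ∃ c : Fin n → Fin n → ℝ, ∀ π, f π = ∑ i, ∑ j, c i j * x (i, j) π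

/-- `f` is `ε`-close to Boolean in `L₀`. -/
def CloseToBooleanL0 {n : ℕ} (ε : ℝ) (f : Equiv.Perm (Fin n) → ℝ) : Prop :=
  prob (fun π => f π ∉ ({0, 1} : Set ℝ)) ≤ ε

/-- The number of unordered pairs of distinct members of `C` whose cosets are not disjoint
as sets of permutations. -/
def numNonDisjoint {n : ℕ} (C : Finset (Fin n × Fin n)) : ℕ :=
  open Classical in
  ((C.powersetCard 2).filter
    (fun s => ¬ (s : Set (Fin n × Fin n)).PairwiseDisjoint coset)).card

/-- `C` is an `ε`-disjoint family of cosets, with hidden constants `A` and `B`: it has at most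
`A n` members, and at most `B ε n²` pairs of its members are not disjoint. -/
def IsEpsDisjoint {n : ℕ} (A B ε : ℝ) (C : Finset (Fin n × Fin n)) : Prop :=
  (C.card : ℝ) ≤ A * n ∧ (numNonDisjoint C : ℝ) ≤ B * ε * (n : ℝ) ^ 2

/-- The function `∑_{(i,j) ∈ C} x_{i,j}`. -/
def cosetSum {n : ℕ} (C : Finset (Fin n × Fin n)) : Equiv.Perm (Fin n) → ℝ :=
  fun π => ∑ p ∈ C, x p π

end SymFKN

end

noncomputable section

namespace SymFKN

open Finset Equiv

variable {n : ℕ}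

/-! Write f(π) = ∑ c i (π i). Composing π with a transposition changes f by an alternating sum of
four coefficients. If two disjoint transpositions both change f at π, then f takes values a, a - s,
a - t, a - s - t with s, t ≠ 0, and these cannot all lie in {0, 1} (`notBoolean_of_alt_ne_zero`).
The four permutations involved are uniform when π is, so such configurations have probability at
most 4ε.

Hence two row differences over disjoint pairs of rows cannot both be far from constant, nor can a
row difference and a column difference. After passing to π⁻¹ if necessary, all column differences
are almost constant; subtracting row and column constants, whose total one row `r` absorbs, makes
every other row sparse, and every column sparse outside `r` (`exists_sparse`). A second count of
pairs of transpositions bounds the support outside `r` by n/8 (`card_support_le`), and Pr[f = 1] ≤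
1/2 bounds the support in `r` by 3n/5 (`card_row_le`). Once the support is at most 3n/4, a given
entry, or compatible pair of entries, is all that π hits in the support with probability of order
1/n, or 1/n². So O(εn) coefficients lie outside {0, 1} and O(εn²) pairs of ones are compatible
(`exists_cosets_of_card_support_le`).

This requires small ε and large n. For large ε the empty family suffices. For bounded n, a small
enough ε makes f exactly Boolean, and integral duality for the assignment problem writes f as a sum
of disjoint cosets (`exists_disjoint_cosets`). The converse is a union bound. -/

/-! ### Probabilities of prescribed and avoided values -/

theorem prob_eq (P : Perm (Fin n) → Prop) [DecidablePred P] :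
    prob P = ((univ.filter P).card : ℝ) / (Fintype.card (Perm (Fin n)) : ℝ) := by
  unfold prob
  congr!

theorem card_perm_pos : (0 : ℝ) < (Fintype.card (Perm (Fin n)) : ℝ) := by
  exact_mod_cast Fintype.card_pos

theorem prob_nonneg (P : Perm (Fin n) → Prop) : 0 ≤ prob P := by
  unfold prob
  positivity

theorem prob_mono {P Q : Perm (Fin n) → Prop} (h : ∀ π, P π → Q π) : prob P ≤ prob Q := by
  classical
  rw [prob_eq, prob_eq]
  gcongr
  exact h _

theorem prob_true : prob (fun _ : Perm (Fin n) => True) = 1 := by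
  classical
  rw [prob_eq, filter_true, card_univ]
  exact div_self card_perm_pos.ne'

theorem prob_le_one (P : Perm (Fin n) → Prop) : prob P ≤ 1 :=
  prob_true (n := n) ▸ prob_mono fun _ _ => trivial

theorem prob_or_le (P Q : Perm (Fin n) → Prop) :
    prob (fun π => P π ∨ Q π) ≤ prob P + prob Q := by
  classical
  rw [prob_eq, prob_eq, prob_eq, ← add_div]
  gcongr
  rw [filter_or]
  exact_mod_cast card_union_le _ _

theorem prob_comp (e : Perm (Fin n) ≃ Perm (Fin n)) (P : Perm (Fin n) → Prop) :
    prob (fun π => P (e π)) = prob P := by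
  classical
  rw [prob_eq, prob_eq]
  congr 2
  exact card_bij (fun π _ => e π) (by simp) (by simp)
    (fun π hπ => ⟨e.symm π, by simpa using hπ, by simp⟩)

theorem prob_mul_right (s : Perm (Fin n)) (P : Perm (Fin n) → Prop) :
    prob (fun π => P (π * s)) = prob P :=
  prob_comp (Equiv.mulRight s) P

theorem prob_mul_left (s : Perm (Fin n)) (P : Perm (Fin n) → Prop) :
    prob (fun π => P (s * π)) = prob P :=
  prob_comp (Equiv.mulLeft s) P

theorem prob_inv (P : Perm (Fin n) → Prop) : prob (fun π => P π⁻¹) = prob P :=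
  prob_comp (Equiv.inv _) P

/-- Double counting: events indexed by `A`, of which at most `M` occur together, all inside `Q`. -/
theorem sum_prob_le {α : Type*} (A : Finset α) (P : α → Perm (Fin n) → Prop)
    (Q : Perm (Fin n) → Prop) (M : ℕ) (hPQ : ∀ a ∈ A, ∀ π, P a π → Q π)
    (hM : ∀ π, ∀ S ⊆ A, (∀ a ∈ S, P a π) → S.card ≤ M) :
    ∑ a ∈ A, prob (P a) ≤ M * prob Q := by
  classical
  simp_rw [prob_eq]
  rw [← sum_div, ← mul_div_assoc]
  gcongr
  norm_cast
  calc ∑ a ∈ A, (univ.filter (P a)).card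
      = ∑ π : Perm (Fin n), (A.filter fun a => P a π).card := by
        simp_rw [card_filter]
        exact sum_comm
    _ ≤ ∑ π : Perm (Fin n), if Q π then M else 0 := by
        refine sum_le_sum fun π _ => ?_
        split_ifs with h
        · exact hM π _ (filter_subset _ _) (by simp)
        · rw [Nat.le_zero, card_eq_zero, filter_eq_empty_iff]
          exact fun a ha hP => h (hPQ a ha π hP)
    _ = M * (univ.filter Q).card := by
        rw [← sum_filter, sum_const, smul_eq_mul, mul_comm]

theorem sum_prob_le_of_disjoint {α : Type*} (A : Finset α) (P : α → Perm (Fin n) → Prop)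
    (Q : Perm (Fin n) → Prop) (hPQ : ∀ a ∈ A, ∀ π, P a π → Q π)
    (hM : ∀ π, ∀ a ∈ A, ∀ b ∈ A, P a π → P b π → a = b) :
    ∑ a ∈ A, prob (P a) ≤ prob Q := by
  have := sum_prob_le A P Q 1 hPQ fun π S hS h =>
    card_le_one.2 fun a ha b hb => hM π a (hS ha) b (hS hb) (h a ha) (h b hb)
  simpa using this

theorem prob_exists_le {α : Type*} (A : Finset α) (P : α → Perm (Fin n) → Prop) :
    prob (fun π => ∃ a ∈ A, P a π) ≤ ∑ a ∈ A, prob (P a) := by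
  classical
  simp_rw [prob_eq]
  rw [← sum_div]
  gcongr
  norm_cast
  calc (univ.filter fun π => ∃ a ∈ A, P a π).card
      ≤ (A.biUnion fun a => univ.filter (P a)).card := by
        refine card_le_card fun π hπ => ?_
        simpa using hπ
    _ ≤ _ := card_biUnion_le

/-- A uniformly random permutation maps given distinct points to given distinct points
with the same probability. -/
theorem prob_embedding {m : ℕ} (a b : Fin m ↪ Fin n) :
    prob (fun π => ∀ t, π (a t) = b t) = 1 / (n.descFactorial m : ℝ) := by
  classical
  have hsame : ∀ b' : Fin m ↪ Fin n,
      prob (fun π => ∀ t, π (a t) = b' t) = prob (fun π => ∀ t, π (a t) = b t) := by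
    intro b'
    -- Left multiplication by `σ` turns one event into the other, so all targets are equally likely;
    -- summing over all of them gives 1.
    obtain ⟨σ, hσ⟩ : ∃ σ : Perm (Fin n), ∀ t, σ (b' t) = b t := by
      let e : Set.range b' ≃ Set.range b :=
        (Equiv.ofInjective b' b'.injective).symm.trans (Equiv.ofInjective b b.injective)
      refine ⟨e.extendSubtype, fun t => ?_⟩
      rw [Equiv.extendSubtype_apply_of_mem e (b' t) ⟨t, rfl⟩]
      simp [e]
    rw [← prob_mul_left σ (fun π => ∀ t, π (a t) = b t)]
    congr 1
    ext π
    refine forall_congr' fun t => ?_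
    rw [Perm.mul_apply, ← hσ t, σ.injective.eq_iff]
  have hsum : ∑ b' : Fin m ↪ Fin n, prob (fun π => ∀ t, π (a t) = b' t) = 1 := by
    apply le_antisymm
    · refine (sum_prob_le_of_disjoint univ _ (fun _ => True) (fun _ _ _ _ => trivial)
        fun π b₁ _ b₂ _ h₁ h₂ => ?_).trans (prob_le_one _)
      ext t
      rw [← h₁ t, h₂ t]
    · rw [← prob_true (n := n)]
      refine (prob_mono fun π _ => ?_).trans (prob_exists_le _ _)
      exact ⟨a.trans π.toEmbedding, mem_univ _, fun t => rfl⟩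
  simp_rw [hsame] at hsum
  rw [sum_const, card_univ, Fintype.card_embedding_eq, Fintype.card_fin, Fintype.card_fin,
    nsmul_eq_mul] at hsum
  exact eq_one_div_of_mul_eq_one_right hsum

theorem prob_one_point (i j : Fin n) : prob (fun π => π i = j) = 1 / (n : ℝ) := by
  have := prob_embedding (n := n) ⟨![i], Function.injective_of_subsingleton _⟩
    ⟨![j], Function.injective_of_subsingleton _⟩
  simpa using this

theorem prob_two_points {i₁ i₂ j₁ j₂ : Fin n} (hi : i₁ ≠ i₂) (hj : j₁ ≠ j₂) :
    prob (fun π => π i₁ = j₁ ∧ π i₂ = j₂) = 1 / ((n : ℝ) * (n - 1)) := by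
  have h := prob_embedding (n := n) ⟨![i₁, i₂], by simpa [Function.Injective, Fin.forall_fin_two] using ⟨hi, hi.symm⟩⟩
    ⟨![j₁, j₂], by simpa [Function.Injective, Fin.forall_fin_two] using ⟨hj, hj.symm⟩⟩
  have hn : 1 ≤ n := i₁.pos
  simpa [Fin.forall_fin_two, Nat.descFactorial_succ, Nat.cast_sub hn, mul_comm] using h

theorem injective_vec_three {α : Type*} {a b c : α} (h₁ : a ≠ b) (h₂ : a ≠ c) (h₃ : b ≠ c) :
    Function.Injective ![a, b, c] := by
  intro s t
  fin_cases s <;> fin_cases t <;> simp [h₁, h₂, h₃, h₁.symm, h₂.symm, h₃.symm]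

theorem injective_vec_four {α : Type*} {a b c d : α} (h₁ : a ≠ b) (h₂ : a ≠ c) (h₃ : a ≠ d)
    (h₄ : b ≠ c) (h₅ : b ≠ d) (h₆ : c ≠ d) :
    Function.Injective ![a, b, c, d] := by
  intro s t
  fin_cases s <;> fin_cases t <;>
    simp [h₁, h₂, h₃, h₄, h₅, h₆, h₁.symm, h₂.symm, h₃.symm, h₄.symm, h₅.symm, h₆.symm]

theorem prob_three_points {i₁ i₂ i₃ j₁ j₂ j₃ : Fin n} (hn : 3 ≤ n)
    (hi₁₂ : i₁ ≠ i₂) (hi₁₃ : i₁ ≠ i₃) (hi₂₃ : i₂ ≠ i₃)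
    (hj₁₂ : j₁ ≠ j₂) (hj₁₃ : j₁ ≠ j₃) (hj₂₃ : j₂ ≠ j₃) :
    prob (fun π => π i₁ = j₁ ∧ π i₂ = j₂ ∧ π i₃ = j₃) = 1 / ((n : ℝ) * (n - 1) * (n - 2)) := by
  have h := prob_embedding (n := n) ⟨![i₁, i₂, i₃], injective_vec_three hi₁₂ hi₁₃ hi₂₃⟩
    ⟨![j₁, j₂, j₃], injective_vec_three hj₁₂ hj₁₃ hj₂₃⟩
  have e : (n.descFactorial 3 : ℝ) = (n : ℝ) * (n - 1) * (n - 2) := by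
    simp only [Nat.descFactorial_succ, Nat.descFactorial_zero]
    push_cast [Nat.sub_zero, Nat.cast_sub (show 1 ≤ n by omega), Nat.cast_sub (show 2 ≤ n by omega)]
    ring
  rw [e] at h
  rw [← h]
  congr 1
  ext π
  simp [Fin.forall_fin_succ]

theorem prob_four_points_ge {i₁ i₂ i₃ i₄ j₁ j₂ j₃ j₄ : Fin n}
    (hi₁₂ : i₁ ≠ i₂) (hi₁₃ : i₁ ≠ i₃) (hi₁₄ : i₁ ≠ i₄) (hi₂₃ : i₂ ≠ i₃) (hi₂₄ : i₂ ≠ i₄)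
    (hi₃₄ : i₃ ≠ i₄) (hj₁₂ : j₁ ≠ j₂) (hj₁₃ : j₁ ≠ j₃) (hj₁₄ : j₁ ≠ j₄) (hj₂₃ : j₂ ≠ j₃)
    (hj₂₄ : j₂ ≠ j₄) (hj₃₄ : j₃ ≠ j₄) :
    1 / (n : ℝ) ^ 4 ≤ prob (fun π => π i₁ = j₁ ∧ π i₂ = j₂ ∧ π i₃ = j₃ ∧ π i₄ = j₄) := by
  have hinj := injective_vec_four hi₁₂ hi₁₃ hi₁₄ hi₂₃ hi₂₄ hi₃₄
  have h := prob_embedding (n := n) ⟨![i₁, i₂, i₃, i₄], hinj⟩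
    ⟨![j₁, j₂, j₃, j₄], injective_vec_four hj₁₂ hj₁₃ hj₁₄ hj₂₃ hj₂₄ hj₃₄⟩
  have hn : 4 ≤ n := by simpa using Fintype.card_le_of_injective _ hinj
  have hpos : 0 < n.descFactorial 4 := Nat.descFactorial_pos.2 hn
  have hle : (n.descFactorial 4 : ℝ) ≤ (n : ℝ) ^ 4 := by
    exact_mod_cast Nat.descFactorial_le_pow n 4
  calc 1 / (n : ℝ) ^ 4 ≤ 1 / (n.descFactorial 4 : ℝ) := by gcongr
    _ = _ := by
      rw [← h]
      congr 1
      ext π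
      simp [Fin.forall_fin_succ]

/-- The probability of hitting `(i, j)` while avoiding a set `F` of other cosets. -/
theorem prob_hit_avoid_ge (hn : 2 ≤ n) (i j : Fin n) (F : Finset (Fin n × Fin n))
    (hF : (i, j) ∉ F) :
    1 / (n : ℝ) * (1 - F.card / (n - 1)) ≤ prob (fun π => π i = j ∧ ∀ p ∈ F, π p.1 ≠ p.2) := by
  have hn' : (2 : ℝ) ≤ n := by exact_mod_cast hn
  have h1 : prob (fun π => π i = j) ≤
      prob (fun π => π i = j ∧ ∀ p ∈ F, π p.1 ≠ p.2) +
        prob (fun π => ∃ p ∈ F, π i = j ∧ π p.1 = p.2) := by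
    refine (prob_mono fun π h => ?_).trans (prob_or_le _ _)
    by_cases hp : ∃ p ∈ F, π p.1 = p.2
    · obtain ⟨p, hp, e⟩ := hp
      exact Or.inr ⟨p, hp, h, e⟩
    · push Not at hp
      exact Or.inl ⟨h, hp⟩
  have h2 : prob (fun π => ∃ p ∈ F, π i = j ∧ π p.1 = p.2) ≤
      ∑ p ∈ F, 1 / ((n : ℝ) * (n - 1)) := by
    refine (prob_exists_le _ _).trans (sum_le_sum fun p hp => ?_)
    -- A member of `F` sharing a row or a column with `(i, j)` cannot be hit together with it.
    by_cases h : i ≠ p.1 ∧ j ≠ p.2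
    · exact (prob_two_points h.1 h.2).le
    · have : prob (fun π => π i = j ∧ π p.1 = p.2) ≤ prob (fun _ : Perm (Fin n) => False) := by
        refine prob_mono fun π hπ => h ⟨fun e => hF ?_, fun e => hF ?_⟩
        · have : p = (i, j) := Prod.ext e.symm (by rw [← hπ.2, ← hπ.1, e])
          exact this ▸ hp
        · have : p = (i, j) := Prod.ext (π.injective (by rw [hπ.2, hπ.1, e])) e.symm
          exact this ▸ hp
      refine this.trans ?_
      classical
      rw [prob_eq]
      simp only [filter_false, card_empty, Nat.cast_zero, zero_div]
      have : (0 : ℝ) ≤ n - 1 := by linarith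
      positivity
  rw [prob_one_point] at h1
  rw [sum_const, nsmul_eq_mul] at h2
  have h3 : 1 / (n : ℝ) * (1 - F.card / (n - 1)) =
      1 / n - F.card * (1 / ((n : ℝ) * (n - 1))) := by
    field_simp
  linarith

theorem prob_two_hits_avoid_ge (hn : 3 ≤ n) {i₁ j₁ i₂ j₂ : Fin n} (hi : i₁ ≠ i₂) (hj : j₁ ≠ j₂)
    (F : Finset (Fin n × Fin n)) (hF₁ : (i₁, j₁) ∉ F) (hF₂ : (i₂, j₂) ∉ F) :
    1 / ((n : ℝ) * (n - 1)) * (1 - F.card / (n - 2)) ≤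
      prob (fun π => (π i₁ = j₁ ∧ π i₂ = j₂) ∧ ∀ p ∈ F, π p.1 ≠ p.2) := by
  have hn' : (3 : ℝ) ≤ n := by exact_mod_cast hn
  have h1 : prob (fun π => π i₁ = j₁ ∧ π i₂ = j₂) ≤
      prob (fun π => (π i₁ = j₁ ∧ π i₂ = j₂) ∧ ∀ p ∈ F, π p.1 ≠ p.2) +
        prob (fun π => ∃ p ∈ F, π i₁ = j₁ ∧ π i₂ = j₂ ∧ π p.1 = p.2) := by
    refine (prob_mono fun π h => ?_).trans (prob_or_le _ _)
    by_cases hp : ∃ p ∈ F, π p.1 = p.2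
    · obtain ⟨p, hp, e⟩ := hp
      exact Or.inr ⟨p, hp, h.1, h.2, e⟩
    · push Not at hp
      exact Or.inl ⟨h, hp⟩
  have h2 : prob (fun π => ∃ p ∈ F, π i₁ = j₁ ∧ π i₂ = j₂ ∧ π p.1 = p.2) ≤
      ∑ p ∈ F, 1 / ((n : ℝ) * (n - 1) * (n - 2)) := by
    refine (prob_exists_le _ _).trans (sum_le_sum fun p hp => ?_)
    by_cases h : (i₁ ≠ p.1 ∧ j₁ ≠ p.2) ∧ (i₂ ≠ p.1 ∧ j₂ ≠ p.2)
    · exact (prob_three_points hn hi h.1.1 h.2.1 hj h.1.2 h.2.2).le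
    · have : prob (fun π => π i₁ = j₁ ∧ π i₂ = j₂ ∧ π p.1 = p.2) ≤
          prob (fun _ : Perm (Fin n) => False) := by
        refine prob_mono fun π ⟨e₁, e₂, e₃⟩ =>
          h ⟨⟨fun e => hF₁ ?_, fun e => hF₁ ?_⟩, ⟨fun e => hF₂ ?_, fun e => hF₂ ?_⟩⟩
        · exact (Prod.ext e.symm (by rw [← e₃, ← e₁, e]) : p = (i₁, j₁)) ▸ hp
        · exact (Prod.ext (π.injective (by rw [e₁, e₃, e])) e.symm : p = (i₁, j₁)) ▸ hp
        · exact (Prod.ext e.symm (by rw [← e₃, ← e₂, e]) : p = (i₂, j₂)) ▸ hp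
        · exact (Prod.ext (π.injective (by rw [e₂, e₃, e])) e.symm : p = (i₂, j₂)) ▸ hp
      refine this.trans ?_
      classical
      rw [prob_eq]
      simp only [filter_false, card_empty, Nat.cast_zero, zero_div]
      have : (0 : ℝ) ≤ n - 1 := by linarith
      have : (0 : ℝ) ≤ n - 2 := by linarith
      positivity
  rw [prob_two_points hi hj] at h1
  rw [sum_const, nsmul_eq_mul] at h2
  have h3 : 1 / ((n : ℝ) * (n - 1)) * (1 - F.card / (n - 2)) =
      1 / ((n : ℝ) * (n - 1)) - F.card * (1 / ((n : ℝ) * (n - 1) * (n - 2))) := by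
    field_simp
  linarith

/-! ### Coefficient matrices, compatible pairs of cosets, and the converse -/

/-- The linear function with coefficient matrix `c`. -/
def lin (c : Fin n → Fin n → ℝ) (π : Perm (Fin n)) : ℝ := ∑ i, c i (π i)

theorem x_apply (p : Fin n × Fin n) (π : Perm (Fin n)) :
    x p π = if π p.1 = p.2 then 1 else 0 := by
  simp [x, coset, Set.indicator_apply]

theorem isLinear_iff (f : Perm (Fin n) → ℝ) : IsLinear f ↔ ∃ c, f = lin c := by
  have h : ∀ (c : Fin n → Fin n → ℝ) π, ∑ i, ∑ j, c i j * x (i, j) π = lin c π := by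
    intro c π
    simp [x_apply, lin]
  simp_rw [IsLinear, h, funext_iff]

theorem cosetSum_apply (C : Finset (Fin n × Fin n)) (π : Perm (Fin n)) :
    cosetSum C π = (C.filter fun p => π p.1 = p.2).card := by
  simp [cosetSum, x_apply]

theorem lin_eq_sum_filter (c : Fin n → Fin n → ℝ) (W : Finset (Fin n × Fin n))
    (hW : ∀ i j, c i j ≠ 0 → (i, j) ∈ W) (π : Perm (Fin n)) :
    lin c π = ∑ p ∈ W.filter (fun p => π p.1 = p.2), c p.1 p.2 := by
  classical
  have h : lin c π = ∑ p ∈ univ.image (fun i => (i, π i)), c p.1 p.2 := by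
    rw [sum_image fun a _ b _ h => (Prod.ext_iff.1 h).1]
    rfl
  rw [h]
  symm
  apply sum_subset
  · rintro ⟨i, j⟩ hp
    simp only [mem_filter] at hp
    simpa using hp.2
  · rintro ⟨i, j⟩ hp hp'
    by_contra hc
    refine hp' (mem_filter.2 ⟨hW _ _ hc, ?_⟩)
    simpa using hp

theorem exists_of_not_pairwiseDisjoint {s : Finset (Fin n × Fin n)} (hs : s.card = 2)
    (h : ¬ (s : Set (Fin n × Fin n)).PairwiseDisjoint coset) :
    ∃ p q, s = {p, q} ∧ p.1 ≠ q.1 ∧ p.2 ≠ q.2 := by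
  classical
  obtain ⟨p, q, hpq, rfl⟩ := card_eq_two.1 hs
  refine ⟨p, q, rfl, ?_⟩
  have h' : ¬ Disjoint (coset p) (coset q) := by
    intro hd
    apply h
    rw [coe_pair, Set.pairwiseDisjoint_insert]
    refine ⟨Set.pairwiseDisjoint_singleton _ _, fun r hr _ => ?_⟩
    rw [Set.mem_singleton_iff.1 hr]
    exact hd
  obtain ⟨π, hp, hq⟩ := Set.not_disjoint_iff.1 h'
  simp only [coset, Set.mem_ofPred_eq] at hp hq
  exact ⟨fun e => hpq (Prod.ext e (by rw [← hp, ← hq, e])),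
    fun e => hpq (Prod.ext (π.injective (by rw [hp, hq, e])) e)⟩

/-- The pairs counted by `numNonDisjoint`. -/
def nonDisjointPairs (C : Finset (Fin n × Fin n)) : Finset (Finset (Fin n × Fin n)) :=
  open Classical in
  (C.powersetCard 2).filter (fun s => ¬ (s : Set (Fin n × Fin n)).PairwiseDisjoint coset)

theorem mem_nonDisjointPairs {C s : Finset (Fin n × Fin n)} (h : s ∈ nonDisjointPairs C) :
    s ⊆ C ∧ ∃ p q, s = {p, q} ∧ p.1 ≠ q.1 ∧ p.2 ≠ q.2 := by
  simp only [nonDisjointPairs, mem_filter, mem_powersetCard] at h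
  exact ⟨h.1.1, exists_of_not_pairwiseDisjoint h.1.2 h.2⟩

theorem pair_mem_nonDisjointPairs {C : Finset (Fin n × Fin n)} {p q : Fin n × Fin n}
    (hp : p ∈ C) (hq : q ∈ C) (hpq : p ≠ q) {π : Perm (Fin n)} (hp' : π p.1 = p.2)
    (hq' : π q.1 = q.2) : {p, q} ∈ nonDisjointPairs C := by
  classical
  simp only [nonDisjointPairs, mem_filter, mem_powersetCard]
  refine ⟨⟨by simp [insert_subset_iff, hp, hq], card_pair hpq⟩, fun h => ?_⟩
  exact Set.disjoint_left.1 (h (by simp) (by simp) hpq : Disjoint (coset p) (coset q)) hp' hq'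

theorem exists_perm_of_ne {p q : Fin n × Fin n} (h₁ : p.1 ≠ q.1) (h₂ : p.2 ≠ q.2) :
    ∃ π : Perm (Fin n), π p.1 = p.2 ∧ π q.1 = q.2 := by
  by_contra! hno
  have h := prob_two_points h₁ h₂
  rw [prob_eq, filter_eq_empty_iff.2 fun π _ hπ => hno π hπ.1 hπ.2] at h
  have hn : (2 : ℝ) ≤ n := by
    have : Nontrivial (Fin n) := ⟨_, _, h₁⟩
    exact_mod_cast Fin.nontrivial_iff_two_le.1 this
  have h3 : 0 < 1 / ((n : ℝ) * (n - 1)) := by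
    have : (0 : ℝ) < n - 1 := by linarith
    positivity
  simp only [card_empty, Nat.cast_zero, zero_div] at h
  linarith

/-- The filter in `numNonDisjoint` runs over the two-element subsets coerced to `Set`; the coercion
is injective, so the count is the same. -/
theorem numNonDisjoint_eq (C : Finset (Fin n × Fin n)) :
    numNonDisjoint C = (nonDisjointPairs C).card := by
  classical
  unfold numNonDisjoint nonDisjointPairs
  symm
  refine card_bij (fun s _ => (s : Set (Fin n × Fin n))) (fun s hs => ?_)
    (fun s _ t _ h => coe_injective h) fun t ht => ?_
  · rw [mem_filter] at hs ⊢
    refine ⟨?_, hs.2⟩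
    simp only [bind_def, pure_def, mem_sup, mem_singleton]
    exact ⟨s, hs.1, rfl⟩
  · rw [mem_filter] at ht
    obtain ⟨ht, hd⟩ := ht
    simp only [bind_def, pure_def, mem_sup, mem_singleton] at ht
    obtain ⟨s, hs, rfl⟩ := ht
    exact ⟨s, mem_filter.2 ⟨hs, hd⟩, rfl⟩

/-- A value outside {0, 1} forces π into two members of `C`. Each compatible pair is hit with
probability 1/(n(n-1)) ≤ 2/n², whence the factor 2. -/
theorem closeToBoolean_cosetSum {A B ε : ℝ} {C : Finset (Fin n × Fin n)}
    (hε : 0 ≤ B * ε) (hC : IsEpsDisjoint A B ε C) : CloseToBooleanL0 (2 * B * ε) (cosetSum C) := by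
  classical
  unfold CloseToBooleanL0
  calc prob (fun π => cosetSum C π ∉ ({0, 1} : Set ℝ))
      ≤ prob (fun π => ∃ s ∈ nonDisjointPairs C, ∀ p ∈ s, π p.1 = p.2) := by
        refine prob_mono fun π hπ => ?_
        rw [cosetSum_apply] at hπ
        have hcard : 1 < (C.filter fun p => π p.1 = p.2).card := by
          by_contra! h
          apply hπ
          interval_cases (C.filter fun p => π p.1 = p.2).card <;> simp
        obtain ⟨p, hp, q, hq, hpq⟩ := one_lt_card.1 hcard
        rw [mem_filter] at hp hq
        exact ⟨{p, q}, pair_mem_nonDisjointPairs hp.1 hq.1 hpq hp.2 hq.2, by simp [hp.2, hq.2]⟩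
    _ ≤ ∑ s ∈ nonDisjointPairs C, prob (fun π => ∀ p ∈ s, π p.1 = p.2) := prob_exists_le _ _
    _ ≤ ∑ s ∈ nonDisjointPairs C, 2 / (n : ℝ) ^ 2 := by
        refine sum_le_sum fun s hs => ?_
        obtain ⟨-, p, q, rfl, h₁, h₂⟩ := mem_nonDisjointPairs hs
        have hn : (2 : ℝ) ≤ n := by
          have : Nontrivial (Fin n) := ⟨_, _, h₁⟩
          exact_mod_cast Fin.nontrivial_iff_two_le.1 this
        have h := prob_two_points h₁ h₂
        simp only [mem_insert, mem_singleton, forall_eq_or_imp, forall_eq]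
        rw [h, div_le_div_iff₀ (by nlinarith) (by positivity)]
        nlinarith
    _ = numNonDisjoint C * (2 / (n : ℝ) ^ 2) := by
        rw [sum_const, nsmul_eq_mul, numNonDisjoint_eq]
    _ ≤ B * ε * (n : ℝ) ^ 2 * (2 / (n : ℝ) ^ 2) := by
        gcongr
        exact hC.2
    _ ≤ 2 * B * ε := by
        rcases eq_or_ne (n : ℝ) 0 with h | h
        · simp [h]
          linarith
        · field_simp
          exact le_rfl

/-! ### Functions of small support -/

/-- A nearly Boolean linear function whose coefficients have small support is close to the
sum of the cosets whose coefficient is `1`. -/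
theorem exists_cosets_of_card_support_le (hn : 32 ≤ n) {ε : ℝ} (c : Fin n → Fin n → ℝ)
    (hc : CloseToBooleanL0 ε (lin c)) (W : Finset (Fin n × Fin n))
    (hW : ∀ i j, (i, j) ∈ W ↔ c i j ≠ 0) (hcard : (W.card : ℝ) ≤ 3 / 4 * n) :
    ∃ C, IsEpsDisjoint 1 5 ε C ∧ prob (fun π => lin c π ≠ cosetSum C π) ≤ 5 * ε := by
  classical
  have hn' : (32 : ℝ) ≤ n := by exact_mod_cast hn
  have hlin := lin_eq_sum_filter c W fun i j => (hW i j).2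
  set C := W.filter fun p => c p.1 p.2 = 1 with hC
  set N := W.filter fun p => c p.1 p.2 ≠ 1 with hN
  have hsub : ∀ s : Finset (Fin n × Fin n), ((W \ s).card : ℝ) ≤ 3 / 4 * n := fun s =>
    le_trans (by exact_mod_cast card_le_card sdiff_subset) hcard
  have hNcard : (N.card : ℝ) * (1 / n) ≤ 5 * ε := by
    -- If `e` is the only entry of `W` hit by π, then f(π) is the coefficient at `e`, which is
    -- neither 0 nor 1. These events are disjoint for distinct `e`.
    have h1 : ∀ e ∈ N, 1 / (n : ℝ) * (1 / 5) ≤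
        prob (fun π => π e.1 = e.2 ∧ ∀ p ∈ W \ {e}, π p.1 ≠ p.2) := by
      intro e _
      refine le_trans ?_ (prob_hit_avoid_ge (by omega) e.1 e.2 (W \ {e}) (by simp))
      gcongr
      have := hsub {e}
      rw [le_sub_comm, div_le_iff₀ (by linarith)]
      linarith
    have h2 : ∑ e ∈ N, prob (fun π => π e.1 = e.2 ∧ ∀ p ∈ W \ {e}, π p.1 ≠ p.2) ≤
        prob (fun π => lin c π ∉ ({0, 1} : Set ℝ)) := by
      refine sum_prob_le_of_disjoint _ _ _ (fun e he π hπ => ?_) fun π a ha b hb hπa hπb => ?_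
      · rw [hN, mem_filter] at he
        have hfil : W.filter (fun p => π p.1 = p.2) = {e} := by
          ext p
          simp only [mem_filter, mem_singleton]
          constructor
          · rintro ⟨hp, hp'⟩
            by_contra hpe
            exact hπ.2 p (by simp [hp, hpe]) hp'
          · rintro rfl
            exact ⟨he.1, hπ.1⟩
        rw [hlin, hfil, sum_singleton]
        simp only [Set.mem_insert_iff, Set.mem_singleton_iff, not_or]
        exact ⟨(hW _ _).1 he.1, he.2⟩
      · by_contra hab
        exact hπa.2 b (by simp [(mem_filter.1 hb).1, Ne.symm hab]) hπb.1
    have h3 := (sum_le_sum h1).trans (h2.trans hc)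
    rw [sum_const, nsmul_eq_mul] at h3
    linarith
  refine ⟨C, ⟨?_, ?_⟩, ?_⟩
  · have : (C.card : ℝ) ≤ W.card := by exact_mod_cast card_le_card (filter_subset _ _)
    linarith
  -- The same count for pairs: hitting exactly the two entries of `s` gives the value 2.
  · have h1 : ∀ s ∈ nonDisjointPairs C, 1 / (n : ℝ) ^ 2 * (1 / 5) ≤
        prob (fun π => (∀ p ∈ s, π p.1 = p.2) ∧ ∀ p ∈ W \ s, π p.1 ≠ p.2) := by
      intro s hs
      obtain ⟨-, p, q, hpq, h₁, h₂⟩ := mem_nonDisjointPairs hs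
      have h := prob_two_hits_avoid_ge (by omega) h₁ h₂ (W \ s) (by simp [hpq]) (by simp [hpq])
      refine le_trans ?_ (h.trans (prob_mono fun π hπ => ⟨?_, hπ.2⟩))
      · have : (0 : ℝ) < n - 1 := by linarith
        gcongr
        · nlinarith
        · have := hsub s
          -- This is 3n/4 ≤ 4(n - 2)/5, which is exactly n ≥ 32.
          rw [le_sub_comm, div_le_iff₀ (by linarith)]
          linarith
      · simpa [hpq] using hπ.1
    have h2 : ∑ s ∈ nonDisjointPairs C,
        prob (fun π => (∀ p ∈ s, π p.1 = p.2) ∧ ∀ p ∈ W \ s, π p.1 ≠ p.2) ≤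
        prob (fun π => lin c π ∉ ({0, 1} : Set ℝ)) := by
      have key : ∀ s ∈ nonDisjointPairs C, ∀ π : Perm (Fin n),
          ((∀ p ∈ s, π p.1 = p.2) ∧ ∀ p ∈ W \ s, π p.1 ≠ p.2) →
          W.filter (fun p => π p.1 = p.2) = s := by
        intro s hs π hπ
        ext p
        simp only [mem_filter]
        constructor
        · rintro ⟨hp, hp'⟩
          by_contra hps
          exact hπ.2 p (by simp [hp, hps]) hp'
        · intro hp
          exact ⟨(mem_filter.1 ((mem_nonDisjointPairs hs).1 hp)).1, hπ.1 p hp⟩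
      refine sum_prob_le_of_disjoint _ _ _ (fun s hs π hπ => ?_) fun π a ha b hb hπa hπb => ?_
      · have hone : ∀ p ∈ s, c p.1 p.2 = 1 := fun p hp =>
          (mem_filter.1 ((mem_nonDisjointPairs hs).1 hp)).2
        rw [hlin, key s hs π hπ, sum_congr rfl hone]
        obtain ⟨-, p, q, rfl, h₁, -⟩ := mem_nonDisjointPairs hs
        rw [sum_pair (fun e => h₁ (by rw [e]))]
        norm_num
      · rw [← key a ha π hπa, key b hb π hπb]
    have h3 := (sum_le_sum h1).trans (h2.trans hc)
    rw [sum_const, nsmul_eq_mul, ← numNonDisjoint_eq] at h3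
    have : (0 : ℝ) < (n : ℝ) ^ 2 := by positivity
    have h4 : (numNonDisjoint C : ℝ) * (1 / (n : ℝ) ^ 2 * (1 / 5)) * (5 * (n : ℝ) ^ 2) ≤
        ε * (5 * (n : ℝ) ^ 2) := by gcongr
    have h5 : (numNonDisjoint C : ℝ) * (1 / (n : ℝ) ^ 2 * (1 / 5)) * (5 * (n : ℝ) ^ 2) =
        numNonDisjoint C := by field_simp
    linarith
  · refine le_trans ?_ hNcard
    calc prob (fun π => lin c π ≠ cosetSum C π)
        ≤ prob (fun π => ∃ p ∈ N, π p.1 = p.2) := by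
          refine prob_mono fun π hπ => ?_
          by_contra! h
          apply hπ
          rw [hlin, cosetSum_apply, hC, filter_filter]
          have : W.filter (fun p => π p.1 = p.2) =
              W.filter (fun p => c p.1 p.2 = 1 ∧ π p.1 = p.2) := by
            refine filter_congr fun p hp => ⟨fun e => ⟨?_, e⟩, fun e => e.2⟩
            by_contra hne
            exact h p (mem_filter.2 ⟨hp, hne⟩) e
          rw [this, sum_congr rfl fun p hp => (mem_filter.1 hp).2.1]
          simp
      _ ≤ ∑ p ∈ N, prob (fun π => π p.1 = p.2) := prob_exists_le _ _
      _ = N.card * (1 / n) := by simp [prob_one_point]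

/-! ### Exactly Boolean linear functions -/

/-- Egerváry's theorem: integral duality for the assignment problem. -/
theorem exists_integral_dual (c : Fin n → Fin n → ℤ) :
    ∃ u v : Fin n → ℤ, (∀ i j, u i + v j ≤ c i j) ∧
      ∃ π : Perm (Fin n), ∑ i, c i (π i) = ∑ i, u i + ∑ j, v j := by
  classical
  -- Take an integral dual solution of greatest value; the identity permutation bounds these values.
  -- Hall's condition for the tight pairs then yields a permutation using only tight pairs.
  obtain ⟨M, ⟨u, v, huv, hM⟩, hmax⟩ := Int.exists_greatest_of_bdd
    (P := fun M => ∃ u v : Fin n → ℤ, (∀ i j, u i + v j ≤ c i j) ∧ ∑ i, u i + ∑ j, v j = M)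
    ⟨∑ i, c i i, by
      rintro _ ⟨u, v, huv, rfl⟩
      rw [← sum_add_distrib]
      exact sum_le_sum fun i _ => huv i i⟩
    ⟨_, fun i => -∑ j, |c i j|, 0, fun i j => by
      have h1 := single_le_sum (f := fun j => |c i j|) (fun j _ => abs_nonneg _) (mem_univ j)
      have h2 := neg_abs_le (c i j)
      simp only [Pi.zero_apply] at h1 ⊢
      omega, rfl⟩
  refine ⟨u, v, huv, ?_⟩
  obtain ⟨g, hg, hgt⟩ := (all_card_le_biUnion_card_iff_exists_injective
    fun i => univ.filter fun j => u i + v j = c i j).1 (by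
      intro S
      by_contra! hS
      set T := S.biUnion fun i => univ.filter fun j => u i + v j = c i j with hT
      -- If `S` violates Hall's condition, this shift stays feasible, because non-tight pairs have
      -- integral slack at least 1, and it raises the dual value by |S| - |T| > 0.
      have := hmax _ ⟨fun i => u i + if i ∈ S then 1 else 0, fun j => v j - if j ∈ T then 1 else 0,
        fun i j => by
          have h := huv i j
          by_cases hi : i ∈ S
          · by_cases hj : j ∈ T
            · simp [hi, hj]
              omega
            · have : u i + v j ≠ c i j := fun e => hj (mem_biUnion.2 ⟨i, hi, by simpa using e⟩)
              simp [hi, hj]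
              omega
          · simp only [hi, if_false]
            split_ifs <;> omega, rfl⟩
      simp only [sum_add_distrib, sum_sub_distrib, sum_boole, filter_mem_eq_inter, univ_inter]
        at this
      omega)
  refine ⟨Equiv.ofBijective g (Finite.injective_iff_bijective.1 hg), ?_⟩
  have hsum : ∑ j, v (Equiv.ofBijective g (Finite.injective_iff_bijective.1 hg) j) = ∑ j, v j :=
    Equiv.sum_comp _ v
  rw [← hsum, ← sum_add_distrib]
  exact sum_congr rfl fun i _ => ((mem_filter.1 (hgt i)).2).symm

/-- Applying the transposition `(i k)` first changes a linear function by an alternating sum. -/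
theorem lin_mul_swap (c : Fin n → Fin n → ℝ) (π : Perm (Fin n)) {i k : Fin n} (hik : i ≠ k) :
    lin c (π * swap i k) = lin c π - (c i (π i) - c i (π k) - c k (π i) + c k (π k)) := by
  classical
  have h : ∀ σ : Perm (Fin n), lin c σ =
      c i (σ i) + c k (σ k) + ∑ a ∈ (univ.erase i).erase k, c a (σ a) := by
    intro σ
    rw [lin, ← add_sum_erase _ _ (mem_univ i),
      ← add_sum_erase _ _ (mem_erase.2 ⟨hik.symm, mem_univ k⟩), add_assoc]
  rw [h, h π]
  have : ∑ a ∈ (univ.erase i).erase k, c a ((π * swap i k) a) =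
      ∑ a ∈ (univ.erase i).erase k, c a (π a) := by
    refine sum_congr rfl fun a ha => ?_
    simp only [mem_erase] at ha
    rw [Perm.mul_apply, swap_apply_of_ne_of_ne ha.2.1 ha.1]
  rw [this]
  simp only [Perm.mul_apply, swap_apply_left, swap_apply_right]
  ring

theorem lin_add_row_col (c : Fin n → Fin n → ℝ) (u v : Fin n → ℝ) (π : Perm (Fin n)) :
    lin (fun i j => c i j + u i + v j) π = lin c π + ∑ i, u i + ∑ j, v j := by
  simp only [lin, sum_add_distrib]
  rw [Equiv.sum_comp π v]

/-- Alternating sums of coefficients based at `o` are differences of two values of the function,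
hence integers. They represent it up to an additive constant, which is then an integer too and is
placed in row `o`. -/
theorem exists_integral_coeff {c : Fin n → Fin n → ℝ} (h : ∀ π, lin c π ∈ ({0, 1} : Set ℝ)) :
    ∃ d : Fin n → Fin n → ℤ, lin c = lin fun i j => (d i j : ℝ) := by
  classical
  rcases n.eq_zero_or_pos with rfl | hn
  · exact ⟨fun _ _ => 0, funext fun π => by simp [lin]⟩
  have hint : ∀ π, ∃ z : ℤ, lin c π = z := by
    intro π
    rcases h π with e | e
    · exact ⟨0, by simpa using e⟩
    · exact ⟨1, by simpa using e⟩
  let o : Fin n := ⟨0, hn⟩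
  have hD : ∀ i j, ∃ z : ℤ, c i j - c i o - c o j + c o o = z := by
    intro i j
    by_cases hi : i = o
    · exact ⟨0, by simp [hi]⟩
    by_cases hj : j = o
    · exact ⟨0, by simp [hj]⟩
    obtain ⟨σ, hσ⟩ : ∃ σ : Perm (Fin n), σ i = j ∧ σ o = o := by
      refine ⟨swap i j, swap_apply_left _ _, swap_apply_of_ne_of_ne (Ne.symm hi) (Ne.symm hj)⟩
    obtain ⟨z, hz⟩ := hint σ
    obtain ⟨w, hw⟩ := hint (σ * swap i o)
    have := lin_mul_swap c σ hi
    rw [hσ.1, hσ.2, hz, hw] at this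
    exact ⟨z - w, by push_cast; linarith⟩
  choose d hd using hD
  have e1 : ∀ π, lin c π = lin (fun i j => (d i j : ℝ)) π + (∑ i, c i o + ∑ j, (c o j - c o o)) := by
    intro π
    rw [← add_assoc, ← lin_add_row_col]
    congr 1
    ext i j
    rw [← hd]
    ring
  obtain ⟨z, hz⟩ : ∃ z : ℤ, ∑ i, c i o + ∑ j, (c o j - c o o) = z := by
    obtain ⟨z, hz⟩ := hint 1
    refine ⟨z - ∑ i, d i i, ?_⟩
    rw [e1] at hz
    push_cast
    simp only [lin, Perm.one_apply] at hz
    linarith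
  refine ⟨fun i j => d i j + if i = o then z else 0, ?_⟩
  ext π
  rw [e1, hz]
  have := lin_add_row_col (fun i j => (d i j : ℝ)) (fun i => if i = o then (z : ℝ) else 0) 0 π
  simp only [sum_ite_eq', mem_univ, if_true, Pi.zero_apply, sum_const_zero, add_zero] at this
  rw [← this]
  congr 1
  ext i j
  push_cast
  rfl

/-- A Boolean linear function vanishing somewhere is a sum of disjoint cosets. -/
theorem exists_disjoint_cosets {c : Fin n → Fin n → ℝ}
    (h : ∀ π, lin c π ∈ ({0, 1} : Set ℝ)) (h0 : ∃ π, lin c π = 0) {B ε : ℝ} (hε : 0 ≤ B * ε) :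
    ∃ C, IsEpsDisjoint 1 B ε C ∧ lin c = cosetSum C := by
  classical
  obtain ⟨d, hd⟩ := exists_integral_coeff h
  obtain ⟨u, v, huv, σ, hσ⟩ := exists_integral_dual d
  have hle : ∀ π : Perm (Fin n), ∑ i, u i + ∑ j, v j ≤ ∑ i, d i (π i) := by
    intro π
    rw [← Equiv.sum_comp π v, ← sum_add_distrib]
    exact sum_le_sum fun i _ => huv i (π i)
  have hcast : ∀ π, lin c π = ((∑ i, d i (π i) : ℤ) : ℝ) := by
    intro π
    rw [hd]
    simp [lin]
  -- The dual optimum is the minimum of f: it is attained at `σ`, and the value 0 occurs.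
  have huv0 : ∑ i, u i + ∑ j, v j = 0 := by
    apply le_antisymm
    · obtain ⟨π, hπ⟩ := h0
      rw [hcast] at hπ
      have := hle π
      rw [Int.cast_eq_zero.1 hπ] at this
      exact this
    · rw [← hσ]
      have : (0 : ℝ) ≤ ((∑ i, d i (σ i) : ℤ) : ℝ) := by
        rw [← hcast]
        rcases h σ with e | e
        · rw [e]
        · rw [Set.mem_singleton_iff.1 e]
          exact zero_le_one
      exact_mod_cast this
  set b : Fin n → Fin n → ℤ := fun i j => d i j - u i - v j with hb
  have hb0 : ∀ i j, 0 ≤ b i j := fun i j => by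
    have := huv i j
    simp only [hb]
    omega
  have hsum : ∀ π : Perm (Fin n), ∑ i, d i (π i) = ∑ i, b i (π i) := by
    intro π
    simp only [hb, sum_sub_distrib]
    rw [Equiv.sum_comp π v]
    omega
  have hle1 : ∀ π : Perm (Fin n), ∑ i, b i (π i) ≤ 1 := by
    intro π
    have : ((∑ i, b i (π i) : ℤ) : ℝ) ≤ 1 := by
      rw [← hsum, ← hcast]
      rcases h π with e | e
      · rw [e]
        exact zero_le_one
      · exact (Set.mem_singleton_iff.1 e).le
    exact_mod_cast this
  -- The reduced coefficients are nonnegative, so each is at most the value of f at a permutation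
  -- through it.
  have hb1 : ∀ i j, b i j ≤ 1 := by
    intro i j
    have h1 := single_le_sum (f := fun a => b a (swap i j a)) (fun a _ => hb0 _ _) (mem_univ i)
    have h2 := hle1 (swap i j)
    simp only [swap_apply_left] at h1
    omega
  have hb01 : ∀ i j, (b i j : ℝ) = if (i, j) ∈ univ.filter (fun p : Fin n × Fin n => b p.1 p.2 = 1)
      then 1 else 0 := by
    intro i j
    have h1 := hb0 i j
    have h2 := hb1 i j
    have : b i j = 0 ∨ b i j = 1 := by omega
    rcases this with e | e <;> simp [e]
  set C := univ.filter (fun p : Fin n × Fin n => b p.1 p.2 = 1) with hC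
  have heq : lin c = cosetSum C := by
    ext π
    rw [hcast, hsum, cosetSum_apply]
    have := lin_eq_sum_filter (fun i j => (b i j : ℝ)) C (fun i j hij => by
      by_contra hn
      rw [hb01, if_neg hn] at hij
      exact hij rfl) π
    rw [sum_congr rfl fun p hp => by rw [hb01, if_pos (mem_filter.1 hp).1]] at this
    simp only [sum_const, nsmul_eq_mul, mul_one] at this
    rw [← this]
    simp [lin]
  have hcos : ∀ π : Perm (Fin n), (C.filter fun p => π p.1 = p.2).card ≤ 1 := by
    intro π
    have h1 := hle1 π
    rw [← hsum] at h1
    have h2 : lin c π ≤ 1 := by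
      rw [hcast]
      exact_mod_cast h1
    rw [heq, cosetSum_apply] at h2
    exact_mod_cast h2
  refine ⟨C, ⟨?_, ?_⟩, heq⟩
  · have h1 := sum_prob_le_of_disjoint C (fun p π => π p.1 = p.2) (fun _ => True)
      (fun _ _ _ _ => trivial) fun π p hp q hq h₁ h₂ =>
        card_le_one.1 (hcos π) p (mem_filter.2 ⟨hp, h₁⟩) q (mem_filter.2 ⟨hq, h₂⟩)
    rw [prob_true] at h1
    simp only [prob_one_point, sum_const, nsmul_eq_mul] at h1
    rcases n.eq_zero_or_pos with rfl | hn
    · simp [eq_empty_of_isEmpty C]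
    · have : (0 : ℝ) < n := by exact_mod_cast hn
      rw [mul_one_div, div_le_one this] at h1
      linarith
  · have : nonDisjointPairs C = ∅ := by
      rw [eq_empty_iff_forall_notMem]
      intro s hs
      obtain ⟨hsC, p, q, rfl, h₁, h₂⟩ := mem_nonDisjointPairs hs
      have hp : p ∈ C := hsC (by simp)
      have hq : q ∈ C := hsC (by simp)
      obtain ⟨π, hπ₁, hπ₂⟩ := exists_perm_of_ne h₁ h₂
      exact h₁ (by rw [card_le_one.1 (hcos π) p (mem_filter.2 ⟨hp, hπ₁⟩) q
        (mem_filter.2 ⟨hq, hπ₂⟩)])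
    rw [numNonDisjoint_eq, this]
    simp only [card_empty, Nat.cast_zero]
    positivity

/-! ### Pairs of disjoint transpositions and spread differences -/

/-- The alternating sum by which the transposition `(i k)` changes a linear function. -/
def alt (c : Fin n → Fin n → ℝ) (i k j l : Fin n) : ℝ := c i j - c i l - c k j + c k l

/-- The event that a linear function takes a value other than `0` and `1`. -/
def NotBoolean (c : Fin n → Fin n → ℝ) (π : Perm (Fin n)) : Prop :=
  lin c π ∉ ({0, 1} : Set ℝ)

/-- Disjointness makes the two changes s and t additive. If a, a - s and a - t are Boolean, then s =
t = ±1 with the sign fixed by a, so a - s - t is 2 or -1. -/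
theorem notBoolean_of_alt_ne_zero {c : Fin n → Fin n → ℝ} {π : Perm (Fin n)}
    {i k i' k' : Fin n} (hik : i ≠ k) (hik' : i' ≠ k') (h₁ : i' ≠ i) (h₂ : i' ≠ k)
    (h₃ : k' ≠ i) (h₄ : k' ≠ k) (h : alt c i k (π i) (π k) ≠ 0)
    (h' : alt c i' k' (π i') (π k') ≠ 0) :
    NotBoolean c π ∨ NotBoolean c (π * swap i k) ∨ NotBoolean c (π * swap i' k') ∨
      NotBoolean c (π * swap i k * swap i' k') := by
  have e₁ := lin_mul_swap c π hik
  have e₂ := lin_mul_swap c π hik'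
  have e₃ := lin_mul_swap c (π * swap i k) hik'
  simp only [Perm.mul_apply, swap_apply_of_ne_of_ne h₁ h₂, swap_apply_of_ne_of_ne h₃ h₄] at e₃
  rw [e₁] at e₃
  change lin c (π * swap i k) = lin c π - alt c i k (π i) (π k) at e₁
  change lin c (π * swap i' k') = lin c π - alt c i' k' (π i') (π k') at e₂
  change lin c (π * swap i k * swap i' k') =
    lin c π - alt c i k (π i) (π k) - alt c i' k' (π i') (π k') at e₃
  by_contra! hcon
  simp only [NotBoolean, not_not, Set.mem_insert_iff, Set.mem_singleton_iff] at hcon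
  obtain ⟨b₀, b₁, b₂, b₃⟩ := hcon
  rw [e₁] at b₁
  rw [e₂] at b₂
  rw [e₃] at b₃
  generalize alt c i k (π i) (π k) = s at *
  generalize alt c i' k' (π i') (π k') = t at *
  generalize lin c π = a at *
  rcases b₀ with rfl | rfl
  · have hs : s = -1 := by
      rcases b₁ with b | b
      · exact absurd (by linarith) h
      · linarith
    have ht : t = -1 := by
      rcases b₂ with b | b
      · exact absurd (by linarith) h'
      · linarith
    subst hs ht
    norm_num at b₃
  · have hs : s = 1 := by
      rcases b₁ with b | b
      · linarith
      · exact absurd (by linarith) h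
    have ht : t = 1 := by
      rcases b₂ with b | b
      · linarith
      · exact absurd (by linarith) h'
    subst hs ht
    norm_num at b₃

/-- No value is taken by `d` outside fewer than `δ n` places. -/
def Spread (δ : ℝ) (d : Fin n → ℝ) : Prop :=
  ∀ w, δ * n < ((univ.filter fun j => d j ≠ w).card : ℝ)

/-- Pairs on which `d` differs, away from `a` and `b`. -/
def differingPairs (d : Fin n → ℝ) (a b : Fin n) : Finset (Fin n × Fin n) :=
  univ.filter fun p => (p.1 ≠ a ∧ p.1 ≠ b) ∧ (p.2 ≠ a ∧ p.2 ≠ b) ∧ d p.1 ≠ d p.2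

theorem mem_differingPairs {d : Fin n → ℝ} {a b : Fin n} {p : Fin n × Fin n} :
    p ∈ differingPairs d a b ↔
      (p.1 ≠ a ∧ p.1 ≠ b) ∧ (p.2 ≠ a ∧ p.2 ≠ b) ∧ d p.1 ≠ d p.2 := by
  simp [differingPairs]

theorem card_filter_ne_ne_ge (P : Fin n → Prop) [DecidablePred P] (a b : Fin n) :
    ((univ.filter P).card : ℝ) - 2 ≤
      ((univ.filter fun j => (j ≠ a ∧ j ≠ b) ∧ P j).card : ℝ) := by
  classical
  have h : univ.filter P ⊆ univ.filter (fun j => (j ≠ a ∧ j ≠ b) ∧ P j) ∪ {a, b} := by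
    intro j hj
    simp only [mem_filter, mem_univ, true_and, mem_union, mem_insert, mem_singleton] at hj ⊢
    tauto
  have h1 := (card_le_card h).trans (card_union_le _ _)
  have h2 := card_le_two (a := a) (b := b)
  have : ((univ.filter P).card : ℝ) ≤
      ((univ.filter fun j => (j ≠ a ∧ j ≠ b) ∧ P j).card : ℝ) + 2 := by
    exact_mod_cast h1.trans (Nat.add_le_add_left h2 _)
  linarith

theorem card_differingPairs_ge {δ : ℝ} {d : Fin n → ℝ} (hd : Spread δ d) (hδ : 2 ≤ δ * n)
    (a b : Fin n) : ((n : ℝ) - 2) * (δ * n - 2) ≤ ((differingPairs d a b).card : ℝ) := by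
  classical
  have hcard : (differingPairs d a b).card =
      ∑ j ∈ univ.filter (fun j => (j ≠ a ∧ j ≠ b) ∧ True),
        (univ.filter fun l => (l ≠ a ∧ l ≠ b) ∧ d l ≠ d j).card := by
    have hinst : differingPairs d a b = univ.filter fun p : Fin n × Fin n =>
      (p.1 ≠ a ∧ p.1 ≠ b) ∧ (p.2 ≠ a ∧ p.2 ≠ b) ∧ d p.1 ≠ d p.2 := by
      ext
      simp [mem_differingPairs]
    rw [hinst, card_filter, Fintype.sum_prod_type, sum_filter]
    refine sum_congr rfl fun j _ => ?_
    by_cases hj : j ≠ a ∧ j ≠ b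
    · rw [if_pos ⟨hj, trivial⟩, card_filter]
      exact sum_congr rfl fun l _ => if_congr
        ⟨fun h => ⟨h.2.1, Ne.symm h.2.2⟩, fun h => ⟨hj, h.1, Ne.symm h.2⟩⟩ rfl rfl
    · simp [hj]
  rw [hcard]
  push_cast
  calc ((n : ℝ) - 2) * (δ * n - 2)
      ≤ ((univ.filter fun j : Fin n => (j ≠ a ∧ j ≠ b) ∧ True).card : ℝ) * (δ * n - 2) := by
        have h := card_filter_ne_ne_ge (fun _ : Fin n => True) a b
        simp only [filter_true, card_univ, Fintype.card_fin] at h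
        gcongr
    _ = ∑ j ∈ univ.filter (fun j : Fin n => (j ≠ a ∧ j ≠ b) ∧ True), (δ * n - 2) := by
        rw [sum_const, nsmul_eq_mul]
    _ ≤ _ := by
        refine sum_le_sum fun j _ => ?_
        have h := card_filter_ne_ne_ge (fun l => d l ≠ d j) a b
        have h' := hd (d j)
        linarith

/-- Two differences of disjoint pairs of rows cannot both be spread. -/
theorem rows_not_spread {c : Fin n → Fin n → ℝ} {ε δ : ℝ} (hc : prob (NotBoolean c) ≤ ε)
    (hδ : 2 ≤ δ * n) {i k i' k' : Fin n} (hik : i ≠ k) (hik' : i' ≠ k') (h₁ : i' ≠ i)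
    (h₂ : i' ≠ k) (h₃ : k' ≠ i) (h₄ : k' ≠ k)
    (hd : Spread δ fun j => c i j - c k j) (hd' : Spread δ fun j => c i' j - c k' j) (hn : 2 ≤ n) :
    (((n : ℝ) - 2) * (δ * n - 2)) ^ 2 * (1 / (n : ℝ) ^ 4) ≤ 4 * ε := by
  classical
  have hn' : (2 : ℝ) ≤ n := by exact_mod_cast hn
  -- The four distinct images of `i`, `k`, `i'`, `k'`. The first pair has nothing to avoid; the
  -- arguments `i i` only fill the slots, at a harmless loss. Each choice has probability at least
  -- 1/n⁴.
  set T := (differingPairs (fun j => c i j - c k j) i i).sigma fun p =>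
    differingPairs (fun j => c i' j - c k' j) p.1 p.2 with hT
  have hcard : (((n : ℝ) - 2) * (δ * n - 2)) ^ 2 ≤ (T.card : ℝ) := by
    rw [hT, card_sigma]
    push_cast
    have h0 : 0 ≤ ((n : ℝ) - 2) * (δ * n - 2) :=
      mul_nonneg (by linarith) (by linarith)
    calc _ ≤ ((differingPairs (fun j => c i j - c k j) i i).card : ℝ) *
          (((n : ℝ) - 2) * (δ * n - 2)) := by
          rw [sq]
          gcongr
          exact card_differingPairs_ge hd hδ _ _
      _ = ∑ p ∈ differingPairs (fun j => c i j - c k j) i i, (((n : ℝ) - 2) * (δ * n - 2)) := by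
          rw [sum_const, nsmul_eq_mul]
      _ ≤ _ := sum_le_sum fun p _ => card_differingPairs_ge hd' hδ _ _
  have hlow : (T.card : ℝ) * (1 / (n : ℝ) ^ 4) ≤
      ∑ t ∈ T, prob (fun π => π i = t.1.1 ∧ π k = t.1.2 ∧ π i' = t.2.1 ∧ π k' = t.2.2) := by
    rw [← nsmul_eq_mul, ← sum_const]
    refine sum_le_sum fun t ht => ?_
    rw [hT, mem_sigma, mem_differingPairs, mem_differingPairs] at ht
    obtain ⟨⟨-, -, hne⟩, ⟨ha, hb⟩, ⟨hc, hd⟩, hne'⟩ := ht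
    exact prob_four_points_ge hik h₁.symm h₃.symm h₂.symm h₄.symm hik' (fun e => hne (by rw [e]))
      ha.symm hc.symm hb.symm hd.symm (fun e => hne' (by rw [e]))
  have hup : ∑ t ∈ T, prob (fun π => π i = t.1.1 ∧ π k = t.1.2 ∧ π i' = t.2.1 ∧ π k' = t.2.2) ≤
      prob (fun π => NotBoolean c π ∨ NotBoolean c (π * swap i k) ∨
        NotBoolean c (π * swap i' k') ∨ NotBoolean c (π * (swap i k * swap i' k'))) := by
    refine sum_prob_le_of_disjoint _ _ _ ?_ ?_
    · rintro ⟨p, q⟩ ht π ⟨e₁, e₂, e₃, e₄⟩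
      rw [hT, mem_sigma, mem_differingPairs, mem_differingPairs] at ht
      rw [← mul_assoc]
      refine notBoolean_of_alt_ne_zero hik hik' h₁ h₂ h₃ h₄ ?_ ?_
      · rw [e₁, e₂]
        intro h
        exact ht.1.2.2 (by simp only [alt] at h; linarith)
      · rw [e₃, e₄]
        intro h
        exact ht.2.2.2 (by simp only [alt] at h; linarith)
    · rintro π ⟨p, q⟩ - ⟨p', q'⟩ - ⟨e₁, e₂, e₃, e₄⟩ ⟨e₁', e₂', e₃', e₄'⟩
      obtain rfl : p = p' := Prod.ext (e₁.symm.trans e₁') (e₂.symm.trans e₂')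
      obtain rfl : q = q' := Prod.ext (e₃.symm.trans e₃') (e₄.symm.trans e₄')
      rfl
  have h4 : prob (fun π => NotBoolean c π ∨ NotBoolean c (π * swap i k) ∨
        NotBoolean c (π * swap i' k') ∨ NotBoolean c (π * (swap i k * swap i' k'))) ≤ 4 * ε := by
    refine (prob_or_le _ _).trans ((add_le_add_right ((prob_or_le _ _).trans
      (add_le_add_right (prob_or_le _ _) _)) _).trans ?_)
    rw [prob_mul_right, prob_mul_right, prob_mul_right]
    linarith
  refine le_trans ?_ (hlow.trans (hup.trans h4))
  gcongr

/-- A difference of rows and a difference of columns cannot both be spread. -/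
theorem row_col_not_spread {c : Fin n → Fin n → ℝ} {ε δ : ℝ} (hc : prob (NotBoolean c) ≤ ε)
    (hδ : 2 ≤ δ * n) {i k j l : Fin n} (hik : i ≠ k) (hjl : j ≠ l)
    (hd : Spread δ fun a => c i a - c k a) (hd' : Spread δ fun a => c a j - c a l) (hn : 2 ≤ n) :
    (((n : ℝ) - 2) * (δ * n - 2)) ^ 2 * (1 / (n : ℝ) ^ 4) ≤ 4 * ε := by
  classical
  have hn' : (2 : ℝ) ≤ n := by exact_mod_cast hn
  set T := differingPairs (fun a => c i a - c k a) j l ×ˢ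
    differingPairs (fun a => c a j - c a l) i k with hT
  have h0 : 0 ≤ ((n : ℝ) - 2) * (δ * n - 2) :=
    mul_nonneg (by linarith) (by linarith)
  have hcard : (((n : ℝ) - 2) * (δ * n - 2)) ^ 2 ≤ (T.card : ℝ) := by
    rw [hT, card_product, sq]
    push_cast
    gcongr
    · exact card_differingPairs_ge hd hδ _ _
    · exact card_differingPairs_ge hd' hδ _ _
  have hlow : (T.card : ℝ) * (1 / (n : ℝ) ^ 4) ≤
      ∑ t ∈ T, prob (fun π => π i = t.1.1 ∧ π k = t.1.2 ∧ π t.2.1 = j ∧ π t.2.2 = l) := by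
    rw [← nsmul_eq_mul, ← sum_const]
    refine sum_le_sum fun t ht => ?_
    rw [hT, mem_product, mem_differingPairs, mem_differingPairs] at ht
    obtain ⟨⟨⟨a₁, a₂⟩, ⟨a₃, a₄⟩, hne⟩, ⟨b₁, b₂⟩, ⟨b₃, b₄⟩, hne'⟩ := ht
    exact prob_four_points_ge hik b₁.symm b₃.symm b₂.symm b₄.symm (fun e => hne' (by rw [e]))
      (fun e => hne (by rw [e])) a₁ a₂ a₃ a₄ hjl
  have hup : ∑ t ∈ T, prob (fun π => π i = t.1.1 ∧ π k = t.1.2 ∧ π t.2.1 = j ∧ π t.2.2 = l) ≤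
      prob (fun π => NotBoolean c π ∨ NotBoolean c (swap j l * π) ∨
        NotBoolean c (π * swap i k) ∨ NotBoolean c (swap j l * (π * swap i k))) := by
    refine sum_prob_le_of_disjoint _ _ _ ?_ ?_
    · rintro ⟨p, i', k'⟩ ht π ⟨e₁, e₂, e₃, e₄⟩
      rw [hT, mem_product, mem_differingPairs, mem_differingPairs] at ht
      obtain ⟨⟨-, -, hne⟩, ⟨b₁, b₂⟩, ⟨b₃, b₄⟩, hne'⟩ := ht
      simp only at e₁ e₂ e₃ e₄ b₁ b₂ b₃ b₄ hne hne'
      -- Transposing two values amounts to transposing their preimages, so the argument for two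
      -- disjoint pairs of rows applies.
      have hcomm : swap j l * π = π * swap i' k' := by
        rw [swap_mul_eq_mul_swap, Perm.inv_eq_iff_eq.2 e₃.symm, Perm.inv_eq_iff_eq.2 e₄.symm]
      rw [← mul_assoc, hcomm]
      refine notBoolean_of_alt_ne_zero (fun e => hne' (by rw [e])) hik b₁.symm b₃.symm b₂.symm
        b₄.symm ?_ ?_
      · rw [e₃, e₄]
        intro h
        exact hne' (by simp only [alt] at h; linarith)
      · rw [e₁, e₂]
        intro h
        exact hne (by simp only [alt] at h; linarith)
    · rintro π ⟨p, q⟩ - ⟨p', q'⟩ - ⟨e₁, e₂, e₃, e₄⟩ ⟨e₁', e₂', e₃', e₄'⟩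
      obtain rfl : p = p' := Prod.ext (e₁.symm.trans e₁') (e₂.symm.trans e₂')
      obtain rfl : q = q' := Prod.ext (π.injective (e₃.trans e₃'.symm))
        (π.injective (e₄.trans e₄'.symm))
      rfl
  have h4 : prob (fun π => NotBoolean c π ∨ NotBoolean c (swap j l * π) ∨
        NotBoolean c (π * swap i k) ∨ NotBoolean c (swap j l * (π * swap i k))) ≤ 4 * ε := by
    refine (prob_or_le _ _).trans ((add_le_add_right ((prob_or_le _ _).trans
      (add_le_add_right (prob_or_le _ _) _)) _).trans ?_)
    rw [prob_mul_left, prob_mul_right, prob_mul_right _ fun π => NotBoolean c (swap j l * π),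
      prob_mul_left]
    linarith
  refine le_trans ?_ (hlow.trans (hup.trans h4))
  gcongr

/-- The left side is at least (1/400000)² = 6.25 · 10⁻¹², which exceeds 4ε. -/
theorem not_of_spread_bound {ε : ℝ} (hn : 1000000 ≤ n) (hε : ε < 1 / 1000000000000)
    (h : (((n : ℝ) - 2) * (1 / 90000 * n - 2)) ^ 2 * (1 / (n : ℝ) ^ 4) ≤ 4 * ε) : False := by
  have hn' : (1000000 : ℝ) ≤ n := by exact_mod_cast hn
  have h1 : (1 / 400000 : ℝ) * (n : ℝ) ^ 2 ≤ ((n : ℝ) - 2) * (1 / 90000 * n - 2) := by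
    have a1 : (1 / 2 : ℝ) * n ≤ n - 2 := by linarith
    have a2 : (1 / 200000 : ℝ) * n ≤ 1 / 90000 * n - 2 := by linarith
    calc (1 / 400000 : ℝ) * (n : ℝ) ^ 2 = (1 / 2 * n) * (1 / 200000 * n) := by ring
      _ ≤ _ := mul_le_mul a1 a2 (by positivity) (by linarith)
  have h2 : ((1 / 400000 : ℝ) * (n : ℝ) ^ 2) ^ 2 * (1 / (n : ℝ) ^ 4) ≤ 4 * ε := by
    refine le_trans ?_ h
    gcongr
  have h3 : ((1 / 400000 : ℝ) * (n : ℝ) ^ 2) ^ 2 * (1 / (n : ℝ) ^ 4) = (1 / 400000) ^ 2 := by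
    have : (n : ℝ) ≠ 0 := by positivity
    field_simp
  rw [h3] at h2
  norm_num at h2
  linarith

/-! ### Normalization to a sparse matrix -/

/-- Changing the coefficients by row and column constants, and one row arbitrarily so as to
compensate, does not change the linear function. -/
theorem exists_normalized (c : Fin n → Fin n → ℝ) (r : Fin n) (u v : Fin n → ℝ) :
    ∃ c' : Fin n → Fin n → ℝ, lin c' = lin c ∧ ∀ i ≠ r, ∀ j, c' i j = c i j - v j - u i := by
  classical
  set w : Fin n → ℝ := fun i => if i = r then ∑ j, v j + ∑ i ∈ univ.erase r, u i else -u i with hw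
  refine ⟨fun i j => c i j + w i + -v j, ?_, fun i hi j => ?_⟩
  · ext π
    rw [lin_add_row_col c w (fun j => -v j), ← add_sum_erase _ w (mem_univ r),
      sum_congr rfl (g := fun i => -u i) fun i hi => by simp [hw, ne_of_mem_erase hi]]
    simp only [hw, if_true, sum_neg_distrib]
    ring
  · simp only [hw, hi, if_false]
    ring

theorem exists_notMem_notMem_notMem {R : Finset (Fin n)} (hR : R.card + 3 < n)
    (a b d : Fin n) : ∃ k, k ∉ R ∧ k ≠ a ∧ k ≠ b ∧ k ≠ d := by
  classical
  have h1 : (R ∪ {a, b, d}).card < (univ : Finset (Fin n)).card := by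
    have := card_union_le R {a, b, d}
    have := card_le_three (a := a) (b := b) (c := d)
    rw [card_univ, Fintype.card_fin]
    omega
  obtain ⟨k, -, hk⟩ := exists_mem_notMem_of_card_lt_card h1
  simp only [mem_union, mem_insert, mem_singleton, not_or] at hk
  exact ⟨k, hk.1, hk.2.1, hk.2.2.1, hk.2.2.2⟩

theorem card_filter_le_add (P Q R : Fin n → Prop) [DecidablePred P] [DecidablePred Q]
    [DecidablePred R] (h : ∀ a, P a → Q a ∨ R a) :
    ((univ.filter P).card : ℝ) ≤ (univ.filter Q).card + (univ.filter R).card := by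
  classical
  have h1 : univ.filter P ⊆ univ.filter Q ∪ univ.filter R := by
    intro a
    simpa using h a
  exact_mod_cast (card_le_card h1).trans (card_union_le _ _)

/-- If no difference of columns is spread, then the coefficients can be normalized so that,
apart from a single row, all rows and columns vanish almost everywhere. -/
theorem exists_sparse {c : Fin n → Fin n → ℝ} {ε : ℝ} (hn : 1000000 ≤ n)
    (hε : ε < 1 / 1000000000000) (hc : prob (NotBoolean c) ≤ ε)
    (hcol : ∀ j l : Fin n, j ≠ l → ¬ Spread (1 / 90000) fun a => c a j - c a l) :
    ∃ (r : Fin n) (c' : Fin n → Fin n → ℝ), lin c' = lin c ∧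
      (∀ i ≠ r, ((univ.filter fun j => c' i j ≠ 0).card : ℝ) ≤ n / 100) ∧
      ∀ j, ((univ.filter fun i => i ≠ r ∧ c' i j ≠ 0).card : ℝ) ≤ n / 100 := by
  classical
  have hn' : (1000000 : ℝ) ≤ n := by exact_mod_cast hn
  let o : Fin n := ⟨0, by omega⟩
  have hv : ∀ j, ∃ v, ((univ.filter fun a => c a j - c a o ≠ v).card : ℝ) ≤ 1 / 90000 * n := by
    intro j
    by_cases hj : j = o
    · refine ⟨0, ?_⟩
      simp [hj]
    · have := hcol j o hj
      simpa [Spread] using this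
  choose v hv using hv
  -- At most n²/90000 entries deviate from the typical column differences `v`, and 90000 = 300², so
  -- at most n/300 rows contain more than n/300 of them.
  set R := univ.filter fun i =>
    (n : ℝ) / 300 < ((univ.filter fun j => c i j - c i o ≠ v j).card : ℝ) with hR
  have hRcard : (R.card : ℝ) ≤ n / 300 := by
    have h1 : ∑ i, ((univ.filter fun j => c i j - c i o ≠ v j).card : ℝ) ≤ n * (1 / 90000 * n) := by
      calc ∑ i, ((univ.filter fun j => c i j - c i o ≠ v j).card : ℝ)
          = ∑ j, ((univ.filter fun a => c a j - c a o ≠ v j).card : ℝ) := by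
            simp_rw [card_filter]
            push_cast
            exact sum_comm
        _ ≤ ∑ j : Fin n, (1 / 90000 * n : ℝ) := sum_le_sum fun j _ => hv j
        _ = _ := by simp
    have h2 : (R.card : ℝ) * (n / 300) ≤
        ∑ i, ((univ.filter fun j => c i j - c i o ≠ v j).card : ℝ) := by
      rw [← nsmul_eq_mul, ← sum_const]
      refine le_trans (sum_le_sum fun i hi => ?_)
        (sum_le_sum_of_subset_of_nonneg (subset_univ R) fun _ _ _ => Nat.cast_nonneg _)
      exact (mem_filter.1 hi).2.le
    have h3 := h2.trans h1
    have hpos : (0 : ℝ) < n / 300 := by linarith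
    refine le_of_mul_le_mul_right (h3.trans_eq ?_) hpos
    ring
  have hRn : R.card + 3 < n := by
    have : (R.card : ℝ) + 3 < n := by linarith
    exact_mod_cast this
  have hgood : ∀ i ∉ R, ((univ.filter fun j => c i j - c i o ≠ v j).card : ℝ) ≤ n / 300 := by
    intro i hi
    by_contra! h
    exact hi (mem_filter.2 ⟨mem_univ _, h⟩)
  -- A row outside `R` is `v` plus a constant almost everywhere; a row whose difference from it is
  -- almost constant would be so too.
  have hspread : ∀ i, (¬ ∃ u, ((univ.filter fun j => c i j - v j ≠ u).card : ℝ) ≤ n / 100) →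
      ∀ k ∉ R, Spread (1 / 90000) fun j => c i j - c k j := by
    intro i hi k hk w
    by_contra! h
    refine hi ⟨w + c k o, ?_⟩
    have h1 := card_filter_le_add (fun j => c i j - v j ≠ w + c k o)
      (fun j => c i j - c k j ≠ w) (fun j => c k j - c k o ≠ v j) fun j hj => by
        by_contra! h2
        exact hj (by linarith)
    have h2 := hgood k hk
    linarith
  -- Pairing two wild rows with two further rows outside `R` would give two spread differences over
  -- disjoint pairs.
  have hwild : ∀ i i', i ≠ i' →
      (¬ ∃ u, ((univ.filter fun j => c i j - v j ≠ u).card : ℝ) ≤ n / 100) →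
      ∃ u, ((univ.filter fun j => c i' j - v j ≠ u).card : ℝ) ≤ n / 100 := by
    intro i i' hii h
    by_contra h'
    obtain ⟨k, hk, hki, hki', -⟩ := exists_notMem_notMem_notMem hRn i i' i
    obtain ⟨k', hk', hk'i, hk'i', hkk⟩ := exists_notMem_notMem_notMem hRn i i' k
    exact not_of_spread_bound hn hε (rows_not_spread hc (by linarith) hki.symm hk'i'.symm hii.symm
      hki'.symm hk'i hkk (hspread i h k hk) (hspread i' h' k' hk') (by omega))
  obtain ⟨r, hr⟩ : ∃ r, ∀ i ≠ r,
      ∃ u, ((univ.filter fun j => c i j - v j ≠ u).card : ℝ) ≤ n / 100 := by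
    by_cases h : ∃ r, ¬ ∃ u, ((univ.filter fun j => c r j - v j ≠ u).card : ℝ) ≤ n / 100
    · obtain ⟨r, hr⟩ := h
      exact ⟨r, fun i hi => hwild r i hi.symm hr⟩
    · push Not at h
      exact ⟨o, fun i _ => h i⟩
  -- The choice `c i o` outside `R` is what makes columns sparse: off row `r`, an entry of column
  -- `j` survives only in `R` or where the column deviates from `v j`.
  have hu : ∀ i, ∃ u, (i ≠ r → ((univ.filter fun j => c i j - v j ≠ u).card : ℝ) ≤ n / 100) ∧
      (i ∉ R → u = c i o) := by
    intro i
    by_cases hi : i ∈ R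
    · by_cases hir : i = r
      · exact ⟨0, fun h => absurd hir h, fun h => absurd hi h⟩
      · obtain ⟨u, hu⟩ := hr i hir
        exact ⟨u, fun _ => hu, fun h => absurd hi h⟩
    · refine ⟨c i o, fun _ => ?_, fun _ => rfl⟩
      have h1 := hgood i hi
      have h2 : (univ.filter fun j => c i j - v j ≠ c i o) =
          univ.filter fun j => c i j - c i o ≠ v j := by
        refine filter_congr fun j _ => not_congr ⟨fun h => ?_, fun h => ?_⟩ <;> linarith
      rw [h2]
      linarith
  choose u hu hu' using hu
  obtain ⟨c', hlin, hc'⟩ := exists_normalized c r u v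
  refine ⟨r, c', hlin, fun i hi => ?_, fun j => ?_⟩
  · refine le_trans ?_ (hu i hi)
    refine Nat.cast_le.2 (card_le_card fun j => ?_)
    simp only [mem_filter, mem_univ, true_and, hc' i hi, sub_ne_zero]
    exact id
  · have h1 := card_filter_le_add (fun i => i ≠ r ∧ c' i j ≠ 0) (fun a => c a j - c a o ≠ v j)
      (fun i => i ∈ R) fun i hi => by
        by_contra! h2
        refine hi.2 ?_
        rw [hc' i hi.1, hu' i h2.2]
        linarith [h2.1]
    rw [filter_univ_mem] at h1
    have := hv j
    linarith

/-! ### Bounding the support -/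

/-- `π` hits exactly `e` in `E₁` and exactly `e'` in `E₂`, and both the transposition of `e.1`
with `k` and the transposition of `e'.1` with `k'` change the linear function. -/
structure IsIsolated (c : Fin n → Fin n → ℝ) (E₁ E₂ : Finset (Fin n × Fin n))
    (e e' : Fin n × Fin n) (k k' : Fin n) (π : Perm (Fin n)) : Prop where
  mem₁ : e ∈ E₁
  mem₂ : e' ∈ E₂
  hit₁ : π e.1 = e.2
  hit₂ : π e'.1 = e'.2
  uniq₁ : ∀ p ∈ E₁, π p.1 = p.2 → p = e
  uniq₂ : ∀ p ∈ E₂, π p.1 = p.2 → p = e'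
  ne₁ : e.1 ≠ k
  ne₂ : e'.1 ≠ k'
  ne₃ : e'.1 ≠ e.1
  ne₄ : e'.1 ≠ k
  ne₅ : k' ≠ e.1
  ne₆ : k' ≠ k
  alt₁ : alt c e.1 k (π e.1) (π k) ≠ 0
  alt₂ : alt c e'.1 k' (π e'.1) (π k') ≠ 0

/-- An isolated π has a non-Boolean permutation σ among its four switchings. For each of the four
switching types, σ comes from at most n² configurations: an unswitched transposition leaves `k` free
but its entry is forced by uniqueness, while a switched one leaves the entry free but forces `k` to
be the preimage of the entry's column under σ. -/
theorem sum_prob_isolated_le {α : Type*} (T : Finset α) (c : Fin n → Fin n → ℝ)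
    (E₁ E₂ : Finset (Fin n × Fin n)) (h₁ : E₁.card ≤ n) (h₂ : E₂.card ≤ n)
    (e e' : α → Fin n × Fin n) (k k' : α → Fin n)
    (hinj : ∀ s t, e s = e t → e' s = e' t → k s = k t → k' s = k' t → s = t) :
    ∑ t ∈ T, prob (IsIsolated c E₁ E₂ (e t) (e' t) (k t) (k' t)) ≤
      4 * ((n * n : ℕ) * prob (NotBoolean c)) := by
  classical
  let I : α → Perm (Fin n) → Prop := fun t => IsIsolated c E₁ E₂ (e t) (e' t) (k t) (k' t)
  have hsplit : ∀ t, prob (I t) ≤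
      prob (fun π => I t π ∧ NotBoolean c π) +
      (prob (fun π => I t (π * swap (e t).1 (k t)) ∧ NotBoolean c π) +
      (prob (fun π => I t (π * swap (e' t).1 (k' t)) ∧ NotBoolean c π) +
      prob (fun π => I t (π * swap (e' t).1 (k' t) * swap (e t).1 (k t)) ∧ NotBoolean c π))) := by
    intro t
    rw [← prob_mul_right (swap (e t).1 (k t))
        (fun π => I t (π * swap (e t).1 (k t)) ∧ NotBoolean c π),
      ← prob_mul_right (swap (e' t).1 (k' t))
        (fun π => I t (π * swap (e' t).1 (k' t)) ∧ NotBoolean c π),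
      ← prob_mul_right (swap (e t).1 (k t) * swap (e' t).1 (k' t))
        (fun π => I t (π * swap (e' t).1 (k' t) * swap (e t).1 (k t)) ∧ NotBoolean c π)]
    simp only [← mul_assoc, mul_swap_mul_self]
    refine (prob_mono fun π h => ?_).trans ((prob_or_le _ _).trans (add_le_add_right
      ((prob_or_le _ _).trans (add_le_add_right (prob_or_le _ _) _)) _))
    have := notBoolean_of_alt_ne_zero h.ne₁ h.ne₂ h.ne₃ h.ne₄ h.ne₅ h.ne₆ h.alt₁ h.alt₂
    tauto
  have hprod : ∀ E : Finset (Fin n × Fin n), E.card ≤ n →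
      (E ×ˢ (univ : Finset (Fin n))).card ≤ n * n := by
    intro E hE
    rw [card_product, card_univ, Fintype.card_fin]
    exact Nat.mul_le_mul_right _ hE
  have hs₁ : ∀ t π, I t (π * swap (e t).1 (k t)) → k t = π⁻¹ (e t).2 := by
    intro t π h
    have := h.hit₁
    rw [Perm.mul_apply, swap_apply_left] at this
    exact Perm.eq_inv_iff_eq.2 this
  have hs₂ : ∀ t π, I t (π * swap (e' t).1 (k' t)) → k' t = π⁻¹ (e' t).2 := by
    intro t π h
    have := h.hit₂
    rw [Perm.mul_apply, swap_apply_left] at this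
    exact Perm.eq_inv_iff_eq.2 this
  have b₀ : ∑ t ∈ T, prob (fun π => I t π ∧ NotBoolean c π) ≤
      (n * n : ℕ) * prob (NotBoolean c) := by
    refine sum_prob_le T _ _ _ (fun t _ π h => h.2) fun π S _ hS => ?_
    calc S.card ≤ (univ : Finset (Fin n × Fin n)).card := by
          refine card_le_card_of_injOn (fun t => (k t, k' t)) (fun _ _ => by simp) ?_
          intro s hs t ht hst
          have hs' := (hS s hs).1
          have ht' := (hS t ht).1
          exact hinj s t (ht'.uniq₁ _ hs'.mem₁ hs'.hit₁) (ht'.uniq₂ _ hs'.mem₂ hs'.hit₂)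
            (Prod.ext_iff.1 hst).1 (Prod.ext_iff.1 hst).2
      _ = n * n := by simp
  have b₁ : ∑ t ∈ T, prob (fun π => I t (π * swap (e t).1 (k t)) ∧ NotBoolean c π) ≤
      (n * n : ℕ) * prob (NotBoolean c) := by
    refine sum_prob_le T _ _ _ (fun t _ π h => h.2) fun π S _ hS => ?_
    refine le_trans ?_ (hprod E₁ h₁)
    refine card_le_card_of_injOn (fun t => (e t, k' t))
      (fun t ht => by simpa using (hS t ht).1.mem₁) ?_
    intro s hs t ht hst
    have hs' := (hS s hs).1
    have ht' := (hS t ht).1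
    obtain ⟨he, hk'⟩ := Prod.ext_iff.1 hst
    simp only at he hk'
    have hk : k s = k t := by rw [hs₁ s π hs', hs₁ t π ht', he]
    rw [he, hk] at hs'
    have hhit := hs'.hit₂
    exact hinj s t he (ht'.uniq₂ _ hs'.mem₂ hhit) hk hk'
  have b₂ : ∑ t ∈ T, prob (fun π => I t (π * swap (e' t).1 (k' t)) ∧ NotBoolean c π) ≤
      (n * n : ℕ) * prob (NotBoolean c) := by
    refine sum_prob_le T _ _ _ (fun t _ π h => h.2) fun π S _ hS => ?_
    refine le_trans ?_ (hprod E₂ h₂)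
    refine card_le_card_of_injOn (fun t => (e' t, k t))
      (fun t ht => by simpa using (hS t ht).1.mem₂) ?_
    intro s hs t ht hst
    have hs' := (hS s hs).1
    have ht' := (hS t ht).1
    obtain ⟨he, hk⟩ := Prod.ext_iff.1 hst
    simp only at he hk
    have hk' : k' s = k' t := by rw [hs₂ s π hs', hs₂ t π ht', he]
    rw [he, hk'] at hs'
    exact hinj s t (ht'.uniq₁ _ hs'.mem₁ hs'.hit₁) he hk hk'
  have b₃ : ∑ t ∈ T, prob (fun π =>
      I t (π * swap (e' t).1 (k' t) * swap (e t).1 (k t)) ∧ NotBoolean c π) ≤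
      (n * n : ℕ) * prob (NotBoolean c) := by
    refine sum_prob_le T _ _ _ (fun t _ π h => h.2) fun π S _ hS => ?_
    have hk : ∀ t ∈ S, k t = π⁻¹ (e t).2 ∧ k' t = π⁻¹ (e' t).2 := by
      intro t ht
      have h := (hS t ht).1
      have e₁ := h.hit₁
      have e₂ := h.hit₂
      rw [Perm.mul_apply, swap_apply_left, Perm.mul_apply,
        swap_apply_of_ne_of_ne h.ne₄.symm h.ne₆.symm] at e₁
      rw [Perm.mul_apply, swap_apply_of_ne_of_ne h.ne₃ h.ne₄, Perm.mul_apply,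
        swap_apply_left] at e₂
      exact ⟨Perm.eq_inv_iff_eq.2 e₁, Perm.eq_inv_iff_eq.2 e₂⟩
    calc S.card ≤ (E₁ ×ˢ E₂).card := by
          refine card_le_card_of_injOn (fun t => (e t, e' t))
            (fun t ht => by simpa using ⟨(hS t ht).1.mem₁, (hS t ht).1.mem₂⟩) ?_
          intro s hs t ht hst
          obtain ⟨he, he'⟩ := Prod.ext_iff.1 hst
          simp only at he he'
          exact hinj s t he he' (by rw [(hk s hs).1, (hk t ht).1, he])
            (by rw [(hk s hs).2, (hk t ht).2, he'])
      _ ≤ n * n := by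
          rw [card_product]
          exact Nat.mul_le_mul h₁ h₂
  have := sum_le_sum fun t (_ : t ∈ T) => hsplit t
  simp only [sum_add_distrib] at this
  change ∑ t ∈ T, prob (I t) ≤ _
  linarith

/-- In the situation of `exists_sparse`, the nonzero coefficients outside of the exceptional row
are few. -/
theorem card_support_le {c : Fin n → Fin n → ℝ} {ε : ℝ} (hn : 1000000 ≤ n)
    (hε : ε < 1 / 1000000000000) (hc : prob (NotBoolean c) ≤ ε) (r : Fin n)
    (hrow : ∀ i ≠ r, ((univ.filter fun j => c i j ≠ 0).card : ℝ) ≤ n / 100)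
    (hcol : ∀ j, ((univ.filter fun i => i ≠ r ∧ c i j ≠ 0).card : ℝ) ≤ n / 100)
    (E : Finset (Fin n × Fin n)) (hE : ∀ i j, (i, j) ∈ E ↔ i ≠ r ∧ c i j ≠ 0) :
    (E.card : ℝ) ≤ n / 8 := by
  classical
  by_contra! hbig
  have hn' : (1000000 : ℝ) ≤ n := by exact_mod_cast hn
  -- With m about n/20, two disjoint sets of size m fit into `E`, m exceeds the n/50 entries that
  -- can share a row or column with a given one, and 2m + 4n/100 ≤ 3n/20.
  obtain ⟨m, hm₁, hm₂⟩ : ∃ m : ℕ, (n : ℝ) / 20 ≤ m ∧ (m : ℝ) ≤ n / 20 + 1 :=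
    ⟨⌈(n : ℝ) / 20⌉₊, Nat.le_ceil _, (Nat.ceil_lt_add_one (by positivity)).le⟩
  have hmn : m ≤ n := by
    have : (m : ℝ) ≤ n := by linarith
    exact_mod_cast this
  obtain ⟨E₁, hE₁, hm1⟩ : ∃ E₁ ⊆ E, E₁.card = m := exists_subset_card_eq (by
    have : (m : ℝ) ≤ E.card := by linarith
    exact_mod_cast this)
  obtain ⟨E₂, hE₂, hm2⟩ : ∃ E₂ ⊆ E \ E₁, E₂.card = m := exists_subset_card_eq (by
    rw [card_sdiff_of_subset hE₁, hm1]
    have : (m + m : ℝ) ≤ E.card := by linarith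
    have : m + m ≤ E.card := by exact_mod_cast this
    omega)
  have hdisj : ∀ p ∈ E₁, p ∉ E₂ := fun p hp hp' => (mem_sdiff.1 (hE₂ hp')).2 hp
  have hE₂' : E₂ ⊆ E := hE₂.trans sdiff_subset
  set D := (E₁ ×ˢ E₂).filter fun q => q.1.1 ≠ q.2.1 ∧ q.1.2 ≠ q.2.2 with hD
  -- Requiring a zero of row `k` in the column of the entry reduces the alternating sum to that
  -- entry, once both coefficients in column `π k` vanish.
  set V : (Fin n × Fin n) × (Fin n × Fin n) → Finset (Fin n) := fun q =>
    univ.filter fun k => (k ≠ r ∧ k ≠ q.1.1 ∧ k ≠ q.2.1) ∧ c k q.1.2 = 0 with hV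
  set V' : (Fin n × Fin n) × (Fin n × Fin n) → Fin n → Finset (Fin n) := fun q k =>
    univ.filter fun k' => (k' ≠ r ∧ k' ≠ q.1.1 ∧ k' ≠ q.2.1 ∧ k' ≠ k) ∧ c k' q.2.2 = 0 with hV'
  set T := D.sigma fun q => (V q).sigma fun k => V' q k with hT
  have hDcard : (m : ℝ) * (m - n / 50) ≤ D.card := by
    have h1 : D = (E₁.sigma fun (p : Fin n × Fin n) =>
        E₂.filter fun q => p.1 ≠ q.1 ∧ p.2 ≠ q.2).map
          (Equiv.sigmaEquivProd _ _).toEmbedding := by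
      ext ⟨p, q⟩
      simp only [hD, mem_filter, mem_product, mem_map_equiv, mem_sigma]
      simp only [Equiv.sigmaEquivProd, Equiv.coe_fn_symm_mk]
      tauto
    rw [h1, card_map, card_sigma]
    push_cast
    rw [← hm1, ← nsmul_eq_mul, ← sum_const]
    refine sum_le_sum fun p hp => ?_
    have h2 : E₂ ⊆ (E₂.filter fun q => p.1 ≠ q.1 ∧ p.2 ≠ q.2) ∪
        ((univ.filter fun j => c p.1 j ≠ 0).image (fun j => (p.1, j)) ∪
          (univ.filter fun i => i ≠ r ∧ c i p.2 ≠ 0).image fun i => (i, p.2)) := by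
      rintro ⟨i, j⟩ hq
      have hq' := (hE i j).1 (hE₂' hq)
      by_cases h1 : p.1 = i
      · exact mem_union_right _ (mem_union_left _ (mem_image.2
          ⟨j, by simp [h1, hq'.2], by rw [h1]⟩))
      by_cases h2 : p.2 = j
      · exact mem_union_right _ (mem_union_right _ (mem_image.2
          ⟨i, by simp [h2, hq'.1, hq'.2], by rw [h2]⟩))
      · exact mem_union_left _ (mem_filter.2 ⟨hq, h1, h2⟩)
    have h3 := (card_le_card h2).trans ((card_union_le _ _).trans (Nat.add_le_add_left
      ((card_union_le _ _).trans (Nat.add_le_add card_image_le card_image_le)) _))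
    have h3' : (E₂.card : ℝ) ≤ (E₂.filter fun q => p.1 ≠ q.1 ∧ p.2 ≠ q.2).card +
        ((univ.filter fun j => c p.1 j ≠ 0).card +
          (univ.filter fun i => i ≠ r ∧ c i p.2 ≠ 0).card) := by exact_mod_cast h3
    have h4 := hrow p.1 ((hE p.1 p.2).1 (hE₁ hp)).1
    have h5 := hcol p.2
    rw [hm2] at h3'
    rw [hm1]
    linarith
  have hcompl : ∀ (j : Fin n) (X : Finset (Fin n)), X.card ≤ 3 →
      (49 / 50 : ℝ) * n ≤ ((univ.filter fun k => (k ≠ r ∧ k ∉ X) ∧ c k j = 0).card : ℝ) := by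
    intro j X hX
    have h1 : (univ : Finset (Fin n)) ⊆ (univ.filter fun k => (k ≠ r ∧ k ∉ X) ∧ c k j = 0) ∪
        ((univ.filter fun i => i ≠ r ∧ c i j ≠ 0) ∪ insert r X) := by
      intro k _
      simp only [mem_union, mem_filter, mem_univ, true_and, mem_insert]
      tauto
    have h2 := (card_le_card h1).trans ((card_union_le _ _).trans (Nat.add_le_add_left
      ((card_union_le _ _).trans (Nat.add_le_add_left
        ((card_insert_le _ _).trans (Nat.succ_le_succ hX)) _)) _))
    rw [card_univ, Fintype.card_fin] at h2
    have h3 : (n : ℝ) ≤ ((univ.filter fun k => (k ≠ r ∧ k ∉ X) ∧ c k j = 0).card : ℝ) +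
        ((univ.filter fun i => i ≠ r ∧ c i j ≠ 0).card + (3 + 1 : ℕ)) := by exact_mod_cast h2
    have h4 := hcol j
    push_cast at h3
    linarith
  have hVcard : ∀ q, (49 / 50 : ℝ) * n ≤ (V q).card := by
    intro q
    convert hcompl q.1.2 {q.1.1, q.2.1} (card_le_two.trans (by norm_num)) using 5
    simp
  have hV'card : ∀ q k, (49 / 50 : ℝ) * n ≤ (V' q k).card := by
    intro q k
    convert hcompl q.2.2 {q.1.1, q.2.1, k} card_le_three using 5
    simp
  have hDnonneg : (0 : ℝ) ≤ m * (m - n / 50) := mul_nonneg (Nat.cast_nonneg _) (by linarith)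
  have hTcard : (m : ℝ) * (m - n / 50) * (49 / 50 * n * (49 / 50 * n)) ≤ T.card := by
    rw [hT, card_sigma]
    push_cast
    calc (m : ℝ) * (m - n / 50) * (49 / 50 * n * (49 / 50 * n))
        ≤ D.card * (49 / 50 * n * (49 / 50 * n)) := by gcongr
      _ = ∑ q ∈ D, (49 / 50 * n * (49 / 50 * n) : ℝ) := by rw [sum_const, nsmul_eq_mul]
      _ ≤ _ := by
        refine sum_le_sum fun q _ => ?_
        rw [card_sigma]
        push_cast
        calc (49 / 50 * n * (49 / 50 * n) : ℝ) ≤ (V q).card * (49 / 50 * n) := by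
              gcongr
              exact hVcard q
          _ = ∑ k ∈ V q, (49 / 50 * n : ℝ) := by rw [sum_const, nsmul_eq_mul]
          _ ≤ _ := sum_le_sum fun k _ => hV'card q k
  have hlow : ∀ t ∈ T, 1 / (n : ℝ) ^ 2 * (4 / 5) ≤
      prob (IsIsolated c E₁ E₂ t.1.1 t.1.2 t.2.1 t.2.2) := by
    rintro ⟨⟨⟨i, j⟩, ⟨i', j'⟩⟩, ⟨k, k'⟩⟩ ht
    simp only [hT, hD, hV, hV', mem_sigma, mem_filter, mem_product, mem_univ, true_and] at ht
    obtain ⟨⟨⟨he, he'⟩, hii, hjj⟩, ⟨⟨hkr, hki, hki'⟩, hkj⟩, ⟨hk'r, hk'i, hk'i', hkk⟩, hk'j⟩ := ht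
    have hir := (hE i j).1 (hE₁ he)
    have hir' := (hE i' j').1 (hE₂' he')
    set S : Fin n → Finset (Fin n) := fun a => univ.filter fun l => c a l ≠ 0 with hS
    -- Avoiding the first part gives uniqueness; avoiding the rest makes the coefficients in columns
    -- `π k` and `π k'` vanish.
    set F : Finset (Fin n × Fin n) := ((E₁ ∪ E₂) \ {(i, j), (i', j')}) ∪
      ({k} ×ˢ (S i ∪ S k) ∪ {k'} ×ˢ (S i' ∪ S k')) with hF
    have hFcard : (F.card : ℝ) ≤ 3 / 20 * n := by
      have h1 : F.card ≤ (m + m) + (((S i).card + (S k).card) + ((S i').card + (S k').card)) := by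
        refine (card_union_le _ _).trans (Nat.add_le_add ?_ ((card_union_le _ _).trans
          (Nat.add_le_add ?_ ?_)))
        · refine (card_le_card sdiff_subset).trans ((card_union_le _ _).trans ?_)
          rw [hm1, hm2]
        · rw [card_product, card_singleton, one_mul]
          exact card_union_le _ _
        · rw [card_product, card_singleton, one_mul]
          exact card_union_le _ _
      have h2 : (F.card : ℝ) ≤
          (m + m) + (((S i).card + (S k).card) + ((S i').card + (S k').card)) := by
        exact_mod_cast h1
      have := hrow i hir.1
      have := hrow k hkr
      have := hrow i' hir'.1
      have := hrow k' hk'r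
      linarith
    have hnot : ∀ p : Fin n × Fin n, p = (i, j) ∨ p = (i', j') → p ∉ F := by
      intro p hp hpF
      simp only [hF, mem_union, mem_sdiff, mem_insert, mem_singleton, mem_product] at hpF
      rcases hpF with ⟨-, h⟩ | ⟨h, -⟩ | ⟨h, -⟩
      · exact h hp
      · rcases hp with rfl | rfl
        · exact hki h.symm
        · exact hki' h.symm
      · rcases hp with rfl | rfl
        · exact hk'i h.symm
        · exact hk'i' h.symm
    have h := prob_two_hits_avoid_ge (by omega) hii hjj F (hnot _ (Or.inl rfl))
      (hnot _ (Or.inr rfl))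
    refine le_trans ?_ (h.trans (prob_mono fun π hπ => ?_))
    · have : (0 : ℝ) < n - 1 := by linarith
      gcongr
      · nlinarith
      · rw [le_sub_comm, div_le_iff₀ (by linarith)]
        linarith
    · obtain ⟨⟨hit, hit'⟩, hav⟩ := hπ
      have havS : ∀ a l, (a = k ∧ (l ∈ S i ∨ l ∈ S k)) ∨ (a = k' ∧ (l ∈ S i' ∨ l ∈ S k')) →
          π a ≠ l := by
        intro a l hal
        refine hav (a, l) ?_
        simp only [hF, mem_union, mem_product, mem_singleton]
        exact Or.inr hal
      have hzero : c i (π k) = 0 ∧ c k (π k) = 0 ∧ c i' (π k') = 0 ∧ c k' (π k') = 0 := by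
        refine ⟨?_, ?_, ?_, ?_⟩ <;> by_contra hne
        · exact havS k _ (Or.inl ⟨rfl, Or.inl (by simpa [hS] using hne)⟩) rfl
        · exact havS k _ (Or.inl ⟨rfl, Or.inr (by simpa [hS] using hne)⟩) rfl
        · exact havS k' _ (Or.inr ⟨rfl, Or.inl (by simpa [hS] using hne)⟩) rfl
        · exact havS k' _ (Or.inr ⟨rfl, Or.inr (by simpa [hS] using hne)⟩) rfl
      have huniq : ∀ p ∈ E₁ ∪ E₂, π p.1 = p.2 → p = (i, j) ∨ p = (i', j') := by
        intro p hp hpπ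
        by_contra hne
        refine hav p ?_ hpπ
        simp only [hF, mem_union, mem_sdiff, mem_insert, mem_singleton]
        exact Or.inl ⟨mem_union.1 hp, hne⟩
      refine ⟨he, he', hit, hit', fun p hp hpπ => ?_, fun p hp hpπ => ?_, hki.symm, hk'i'.symm,
        hii.symm, hki'.symm, hk'i, hkk, ?_, ?_⟩
      · rcases huniq p (mem_union_left _ hp) hpπ with e | e
        · exact e
        · exact absurd he' (hdisj _ (e ▸ hp))
      · rcases huniq p (mem_union_right _ hp) hpπ with e | e
        · exact absurd (e ▸ hp) (hdisj _ he)
        · exact e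
      · simp only [alt, hit, hzero, hkj]
        simpa using hir.2
      · simp only [alt, hit', hzero, hk'j]
        simpa using hir'.2
  have hup := sum_prob_isolated_le T c E₁ E₂ (by omega) (by omega) (fun t => t.1.1)
    (fun t => t.1.2) (fun t => t.2.1) (fun t => t.2.2) (by
      rintro ⟨⟨e, e'⟩, ⟨k, k'⟩⟩ ⟨⟨f, f'⟩, ⟨l, l'⟩⟩ h₁ h₂ h₃ h₄
      simp only at h₁ h₂ h₃ h₄
      subst h₁ h₂ h₃ h₄
      rfl)
  have hsum := sum_le_sum hlow
  rw [sum_const, nsmul_eq_mul] at hsum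
  have hm3 : (n : ℝ) / 20 * (3 / 100 * n) ≤ m * (m - n / 50) :=
    mul_le_mul hm₁ (by linarith) (by positivity) (Nat.cast_nonneg _)
  -- The left side is about n²/1000, far above 4εn².
  have hfin : (n : ℝ) / 20 * (3 / 100 * n) * (49 / 50 * n * (49 / 50 * n)) *
      (1 / (n : ℝ) ^ 2 * (4 / 5)) ≤ 4 * ((n * n) * ε) := by
    calc _ ≤ (T.card : ℝ) * (1 / (n : ℝ) ^ 2 * (4 / 5)) := by
          gcongr
          exact le_trans (by gcongr) hTcard
      _ ≤ 4 * ((n * n : ℕ) * prob (NotBoolean c)) := hsum.trans hup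
      _ ≤ _ := by
          push_cast
          gcongr
  have hfin' : (n : ℝ) / 20 * (3 / 100 * n) * (49 / 50 * n * (49 / 50 * n)) *
      (1 / (n : ℝ) ^ 2 * (4 / 5)) = (1 / 20 * (3 / 100) * (49 / 50) * (49 / 50) * (4 / 5)) *
        (n * n : ℝ) := by
    have : (n : ℝ) ≠ 0 := by positivity
    field_simp
  rw [hfin'] at hfin
  have hnn : (0 : ℝ) < n * n := by positivity
  nlinarith

/-- When at most half of the values are `1`, the coefficients of the exceptional row do not vanish
on at most about three fifths of the places. -/
theorem card_row_le {c : Fin n → Fin n → ℝ} {ε : ℝ} (hn : 1000000 ≤ n)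
    (hε : ε < 1 / 1000000000000) (hc : prob (NotBoolean c) ≤ ε)
    (hhalf : prob (fun π => lin c π = 1) ≤ 1 / 2) (r : Fin n)
    (E : Finset (Fin n × Fin n)) (hE : ∀ i j, (i, j) ∈ E ↔ i ≠ r ∧ c i j ≠ 0)
    (hEcard : (E.card : ℝ) ≤ n / 8) :
    ((univ.filter fun j => c r j ≠ 0).card : ℝ) ≤ 3 / 5 * n := by
  classical
  have hn' : (1000000 : ℝ) ≤ n := by exact_mod_cast hn
  -- Avoiding `E`, which costs a factor of at most 6/7, leaves only the exceptional row, so its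
  -- entries are values of f.
  have hval : ∀ j π, (π r = j ∧ ∀ p ∈ E, π p.1 ≠ p.2) → lin c π = c r j := by
    rintro j π ⟨rfl, h⟩
    refine sum_eq_single r (fun i _ hi => ?_) (fun h => absurd (mem_univ r) h)
    by_contra hne
    exact h (i, π i) ((hE _ _).2 ⟨hi, hne⟩) rfl
  have hbound : ∀ (S : Finset (Fin n)) (Q : Perm (Fin n) → Prop),
      (∀ j ∈ S, ∀ π, lin c π = c r j → Q π) →
      (S.card : ℝ) * (1 / n * (6 / 7)) ≤ prob Q := by
    intro S Q hQ
    calc (S.card : ℝ) * (1 / n * (6 / 7)) = ∑ j ∈ S, (1 / n * (6 / 7) : ℝ) := by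
          rw [sum_const, nsmul_eq_mul]
      _ ≤ ∑ j ∈ S, prob (fun π => π r = j ∧ ∀ p ∈ E, π p.1 ≠ p.2) := by
          refine sum_le_sum fun j _ => ?_
          refine le_trans ?_ (prob_hit_avoid_ge (by omega) r j E fun h => ((hE r j).1 h).1 rfl)
          gcongr
          rw [le_sub_comm, div_le_iff₀ (by linarith)]
          linarith
      _ ≤ prob Q := sum_prob_le_of_disjoint _ _ _ (fun j hj π h => hQ j hj π (hval j π h))
          fun π a _ b _ ha hb => ha.1.symm.trans hb.1
  have h1 := (hbound (univ.filter fun j => c r j = 1) (fun π => lin c π = 1)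
    fun j hj π h => h.trans (mem_filter.1 hj).2).trans hhalf
  have h2 := (hbound (univ.filter fun j => c r j ∉ ({0, 1} : Set ℝ)) (NotBoolean c)
    fun j hj π h => by
      rw [NotBoolean, h]
      exact (mem_filter.1 hj).2).trans hc
  have h3 := card_filter_le_add (fun j => c r j ≠ 0) (fun j => c r j = 1)
    (fun j => c r j ∉ ({0, 1} : Set ℝ)) fun j hj => by
      simp only [Set.mem_insert_iff, Set.mem_singleton_iff, not_or]
      tauto
  have hpos : (0 : ℝ) < n := by linarith
  -- Multiplying by 7n/6 gives just over 7n/12, below 3n/5.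
  have h4 : (((univ.filter fun j => c r j ≠ 0).card : ℝ)) * (1 / n * (6 / 7)) ≤ 1 / 2 + ε := by
    calc _ ≤ _ := mul_le_mul_of_nonneg_right h3 (by positivity)
      _ ≤ _ := by
        rw [add_mul]
        exact add_le_add h1 h2
  have h5 : (((univ.filter fun j => c r j ≠ 0).card : ℝ)) =
      ((univ.filter fun j => c r j ≠ 0).card : ℝ) * (1 / n * (6 / 7)) * (7 / 6 * n) := by
    field_simp
  rw [h5]
  calc _ ≤ (1 / 2 + ε) * (7 / 6 * n) := by gcongr
    _ ≤ (1 / 2 + 1 / 1000000000000) * (7 / 6 * n) := by gcongr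
    _ ≤ _ := by linarith

/-! ### Assembling the direct part -/

/-- The conclusion of the direct part of the theorem for the linear function with coefficients `c`. -/
def HasApproximation (ε : ℝ) (c : Fin n → Fin n → ℝ) : Prop :=
  ∃ C, IsEpsDisjoint 1 5 ε C ∧ prob (fun π => lin c π ≠ cosetSum C π) ≤ 5 * ε

theorem hasApproximation_of_columns {c : Fin n → Fin n → ℝ} {ε : ℝ} (hn : 1000000 ≤ n)
    (hε : ε < 1 / 1000000000000) (hc : prob (NotBoolean c) ≤ ε)
    (hhalf : prob (fun π => lin c π = 1) ≤ 1 / 2)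
    (hcol : ∀ j l : Fin n, j ≠ l → ¬ Spread (1 / 90000) fun a => c a j - c a l) :
    HasApproximation ε c := by
  classical
  obtain ⟨r, d, hd, hrow, hcol⟩ := exists_sparse hn hε hc hcol
  have hc' : prob (NotBoolean d) ≤ ε := by
    unfold NotBoolean
    rw [hd]
    exact hc
  rw [← hd] at hhalf
  set E := univ.filter fun p : Fin n × Fin n => p.1 ≠ r ∧ d p.1 p.2 ≠ 0 with hE
  have hEmem : ∀ i j, (i, j) ∈ E ↔ i ≠ r ∧ d i j ≠ 0 := by simp [hE]
  have hEcard := card_support_le hn hε hc' r hrow hcol E hEmem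
  have hrcard := card_row_le hn hε hc' hhalf r E hEmem hEcard
  have hW : (((univ.filter fun p : Fin n × Fin n => d p.1 p.2 ≠ 0).card : ℕ) : ℝ) ≤ 3 / 4 * n := by
    have h1 : (univ.filter fun p : Fin n × Fin n => d p.1 p.2 ≠ 0) ⊆
        E ∪ (univ.filter fun j => d r j ≠ 0).image fun j => (r, j) := by
      rintro ⟨i, j⟩ hp
      have hp' : d i j ≠ 0 := by simpa using hp
      by_cases hi : i = r
      · exact mem_union_right _ (mem_image.2 ⟨j, by simpa [← hi] using hp', by rw [hi]⟩)
      · exact mem_union_left _ ((hEmem i j).2 ⟨hi, hp'⟩)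
    have h2 := (card_le_card h1).trans ((card_union_le _ _).trans
      (Nat.add_le_add_left card_image_le _))
    have h3 : (((univ.filter fun p : Fin n × Fin n => d p.1 p.2 ≠ 0).card : ℕ) : ℝ) ≤
        E.card + (univ.filter fun j => d r j ≠ 0).card := by exact_mod_cast h2
    have hn' : (1000000 : ℝ) ≤ n := by exact_mod_cast hn
    linarith
  unfold HasApproximation
  rw [← hd]
  exact exists_cosets_of_card_support_le (by omega) d hc' _ (by simp) hW

theorem lin_transpose (c : Fin n → Fin n → ℝ) (π : Perm (Fin n)) :
    lin (fun i j => c j i) π = lin c π⁻¹ := by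
  unfold lin
  rw [← Equiv.sum_comp π fun i => c i (π⁻¹ i)]
  simp

/-- Inversion π ↦ π⁻¹ preserves the uniform measure and exchanges rows with columns. -/
theorem HasApproximation.transpose {c : Fin n → Fin n → ℝ} {ε : ℝ}
    (h : HasApproximation ε fun i j => c j i) : HasApproximation ε c := by
  classical
  obtain ⟨C, ⟨hC₁, hC₂⟩, hprob⟩ := h
  refine ⟨C.image Prod.swap, ⟨?_, ?_⟩, ?_⟩
  · rwa [card_image_of_injective _ Prod.swap_injective]
  · refine le_trans ?_ hC₂
    rw [numNonDisjoint_eq, numNonDisjoint_eq]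
    refine Nat.cast_le.2 (card_le_card_of_injOn (fun s => s.image Prod.swap) (fun s hs => ?_)
      (image_injective Prod.swap_injective).injOn)
    obtain ⟨hsC, p, q, rfl, h₁, h₂⟩ := mem_nonDisjointPairs hs
    obtain ⟨π, hp, hq⟩ := exists_perm_of_ne (p := p.swap) (q := q.swap) h₂ h₁
    have hmem : ∀ t ∈ ({p, q} : Finset (Fin n × Fin n)), t.swap ∈ C := by
      intro t ht
      obtain ⟨w, hw, rfl⟩ := mem_image.1 (hsC ht)
      rwa [Prod.swap_swap]
    simp only [image_insert, image_singleton]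
    exact pair_mem_nonDisjointPairs (hmem p (by simp)) (hmem q (by simp))
      (fun e => h₁ (by rw [Prod.swap_injective e])) hp hq
  · refine le_trans (le_of_eq ?_) hprob
    rw [← prob_inv]
    congr 1
    ext π
    have : cosetSum (C.image Prod.swap) π⁻¹ = cosetSum C π := by
      unfold cosetSum
      rw [sum_image Prod.swap_injective.injOn]
      refine sum_congr rfl fun p _ => ?_
      simp only [x_apply, Prod.fst_swap, Prod.snd_swap, Perm.inv_eq_iff_eq]
      simp only [eq_comm]
    rw [this, lin_transpose c π]

/-- If some column difference is spread, then no row difference is, and the transposed matrix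
satisfies the hypothesis on columns. -/
theorem hasApproximation_of_large {c : Fin n → Fin n → ℝ} {ε : ℝ} (hn : 1000000 ≤ n)
    (hε : ε < 1 / 1000000000000) (hc : prob (NotBoolean c) ≤ ε)
    (hhalf : prob (fun π => lin c π = 1) ≤ 1 / 2) : HasApproximation ε c := by
  by_cases hcol : ∀ j l : Fin n, j ≠ l → ¬ Spread (1 / 90000) fun a => c a j - c a l
  · exact hasApproximation_of_columns hn hε hc hhalf hcol
  · push Not at hcol
    obtain ⟨j, l, hjl, hs⟩ := hcol
    refine HasApproximation.transpose (hasApproximation_of_columns hn hε ?_ ?_ ?_)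
    · unfold NotBoolean
      simp_rw [lin_transpose]
      rw [prob_inv (fun π => lin c π ∉ ({0, 1} : Set ℝ))]
      exact hc
    · simp_rw [lin_transpose]
      rwa [prob_inv (fun π => lin c π = 1)]
    · intro i k hik hs'
      have hn' : (1000000 : ℝ) ≤ n := by exact_mod_cast hn
      exact not_of_spread_bound hn hε
        (row_col_not_spread hc (by linarith) hik hjl hs' hs (by omega))

/-- A nonempty event has probability at least 1/n!, so f is exactly Boolean; the bound 1/2 excludes
f = 1 everywhere. -/
theorem hasApproximation_of_prob_lt {c : Fin n → Fin n → ℝ} {ε : ℝ} (hε₀ : 0 ≤ ε)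
    (hε : ε * n.factorial < 1) (hc : prob (NotBoolean c) ≤ ε)
    (hhalf : prob (fun π => lin c π = 1) ≤ 1 / 2) : HasApproximation ε c := by
  classical
  have hbool : ∀ π, lin c π ∈ ({0, 1} : Set ℝ) := by
    intro π
    by_contra hπ
    have h1 : (1 : ℝ) ≤ ((univ.filter (NotBoolean c)).card : ℝ) := by
      exact_mod_cast card_pos.2 ⟨π, mem_filter.2 ⟨mem_univ _, hπ⟩⟩
    rw [prob_eq, div_le_iff₀ card_perm_pos, Fintype.card_perm, Fintype.card_fin] at hc
    linarith
  have h0 : ∃ π, lin c π = 0 := by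
    by_contra! hne
    have h1 : (fun π => lin c π = 1) = fun _ => True := by
      ext π
      have := hbool π
      have := hne π
      simp_all
    rw [h1, prob_true] at hhalf
    norm_num at hhalf
  obtain ⟨C, hC, heq⟩ := exists_disjoint_cosets hbool h0 (B := 5) (ε := ε) (by positivity)
  refine ⟨C, hC, ?_⟩
  rw [heq, prob_eq]
  simpa using hε₀

theorem exists_factorial_bound (N : ℕ) : ∃ F : ℝ, 0 ≤ F ∧ ∀ n < N, (n.factorial : ℝ) ≤ F :=
  ⟨∑ n ∈ range N, (n.factorial : ℝ), sum_nonneg fun _ _ => Nat.cast_nonneg _, fun _ hn =>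
    single_le_sum (f := fun n => (n.factorial : ℝ)) (fun _ _ => Nat.cast_nonneg _)
      (mem_range.2 hn)⟩

end SymFKN
end

theorem theorem3 :
    -- direct part: the constants are absolute
    (∃ A B K : ℝ, 0 < A ∧ 0 < B ∧ 0 < K ∧
      ∀ (n : ℕ) (ε : ℝ) (f : Equiv.Perm (Fin n) → ℝ),
        SymFKN.IsLinear f →
        SymFKN.CloseToBooleanL0 ε f →
        SymFKN.prob (fun π => f π = 1) ≤ 1 / 2 →
        ∃ C : Finset (Fin n × Fin n),
          SymFKN.IsEpsDisjoint A B ε C ∧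
          SymFKN.prob (fun π => f π ≠ SymFKN.cosetSum C π) ≤ K * ε) ∧
    -- converse part: the constants of the family are arbitrary
    (∀ A B : ℝ, 0 < A → 0 < B → ∃ K : ℝ, 0 < K ∧
      ∀ (n : ℕ) (ε : ℝ), 0 ≤ ε → ∀ C : Finset (Fin n × Fin n),
        SymFKN.IsEpsDisjoint A B ε C →
        SymFKN.CloseToBooleanL0 (K * ε) (SymFKN.cosetSum C)) := by
  constructor
  · obtain ⟨F, hF₀, hF⟩ := SymFKN.exists_factorial_bound 1000000
    -- If Kε ≥ 1 the empty family works. Otherwise the summands of K give ε < 10⁻¹² for large n, and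
    -- ε · n! < 1 for n < 10⁶, since `F` bounds n! there.
    refine ⟨1, 5, 1000000000005 + F, one_pos, by norm_num, by linarith, ?_⟩
    intro n ε f hlin hc hhalf
    obtain ⟨c, rfl⟩ := (SymFKN.isLinear_iff f).1 hlin
    have hε : 0 ≤ ε := (SymFKN.prob_nonneg _).trans hc
    by_cases htriv : 1 ≤ (1000000000005 + F) * ε
    · refine ⟨∅, ⟨by simp, ?_⟩, (SymFKN.prob_le_one _).trans htriv⟩
      have : SymFKN.nonDisjointPairs (∅ : Finset (Fin n × Fin n)) = ∅ := by
        rw [Finset.eq_empty_iff_forall_notMem]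
        intro s hs
        obtain ⟨hs, p, q, rfl, -⟩ := SymFKN.mem_nonDisjointPairs hs
        exact absurd (hs (Finset.mem_insert_self p _)) (Finset.notMem_empty p)
      rw [SymFKN.numNonDisjoint_eq, this]
      simp only [Finset.card_empty, Nat.cast_zero]
      positivity
    · push Not at htriv
      have hFε : 0 ≤ F * ε := mul_nonneg hF₀ hε
      obtain ⟨C, hC, hprob⟩ : SymFKN.HasApproximation ε c := by
        rcases lt_or_ge n 1000000 with hn | hn
        · refine SymFKN.hasApproximation_of_prob_lt hε ?_ hc hhalf
          have := mul_le_mul_of_nonneg_left (hF n hn) hε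
          linarith
        · exact SymFKN.hasApproximation_of_large hn (by linarith) hc hhalf
      refine ⟨C, hC, hprob.trans ?_⟩
      linarith
  · intro A B _ hB
    exact ⟨2 * B, by positivity, fun n ε hε C hC =>
      SymFKN.closeToBoolean_cosetSum (mul_nonneg hB.le hε) hC⟩
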